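/- Let $IR(3,\mathbb F_2)$ denote the poset, ordered by inclusion, of all subsets $E\subseteq\mathbb F_2^3\setminus\{0\}$ such that the matroid of linear independence over $\mathbb F_2$ on $E$ is a regular matroid of rank $3$, where a matroid is \emph{regular} if it is represented over $\mathbb R$ by the columns of a totally unimodular matrix. Let $|IR(3,\mathbb F_2)|$ be its geometric realization, that is, the geometric realization of the simplicial complex whose $k$-simplices are the chains $x_0<x_1<\cdots<x_k$ of the poset. \textbf{Theorem.} $|IR(3,\mathbb F_2)|$ is homotopy equivalent to a wedge of eight $3$-spheres: $$|IR(3,\mathbb F_2)|\simeq\bigvee_8 S^3 .$$ -/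

import Mathlib

open Metric

/-! ### Matroids of vectors and regular matroids -/

section Matroids

/-- Steinitz augmentation for finite linearly independent sets of vectors. -/
theorem linearIndepOn_augment {K V : Type*} [Field K] [AddCommGroup V] [Module K V]
    {I J : Set V} (hIfin : I.Finite) (hJfin : J.Finite)
    (hI : LinearIndepOn K id I) (hJ : LinearIndepOn K id J) (h : I.ncard < J.ncard) :
    ∃ e ∈ J, e ∉ I ∧ LinearIndepOn K id (insert e I) := by
  by_contra hcon
  push Not at hcon
  have hsub : J ⊆ (Submodule.span K I : Set V) := by
    intro e he
    by_cases heI : e ∈ I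
    · exact Submodule.subset_span heI
    · by_contra hspan
      exact hcon e he heI (hI.insert (by simpa using hspan))
  have hle : Submodule.span K J ≤ Submodule.span K I := Submodule.span_le.2 hsub
  have := hIfin.fintype
  have := hJfin.fintype
  have : FiniteDimensional K (Submodule.span K I) := FiniteDimensional.span_of_finite K hIfin
  have h1 := Submodule.finrank_mono hle
  rw [finrank_span_set_eq_card hJ, finrank_span_set_eq_card hI, ← Set.ncard_eq_toFinset_card',
    ← Set.ncard_eq_toFinset_card'] at h1
  omega

/-- The matroid of linear independence on a finite set `E` of vectors of a `K`-vector space `V`: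
its ground set is `E` and its independent sets are the linearly independent subsets of `E`. -/
def vectorMatroid (K : Type*) {V : Type*} [Field K] [AddCommGroup V] [Module K V]
    (E : Finset V) : Matroid V :=
  (IndepMatroid.ofFinite (E := (E : Set V)) E.finite_toSet
    (fun I => I ⊆ (E : Set V) ∧ LinearIndepOn K id I)
    ⟨Set.empty_subset _, linearIndepOn_empty K id⟩
    (fun _ _ hJ hIJ => ⟨hIJ.trans hJ.1, hJ.2.mono hIJ⟩)
    (fun _ _ hI hJ hlt => by
      obtain ⟨e, heJ, heI, he⟩ := linearIndepOn_augment (E.finite_toSet.subset hI.1)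
        (E.finite_toSet.subset hJ.1) hI.2 hJ.2 hlt
      exact ⟨e, heJ, heI, Set.insert_subset (hJ.1 heJ) hI.1, he⟩)
    (fun _ hI => hI.1)).matroid

theorem vectorMatroid_ground (K : Type*) {V : Type*} [Field K] [AddCommGroup V] [Module K V]
    (E : Finset V) : (vectorMatroid K E).E = (E : Set V) := rfl

theorem vectorMatroid_indep_iff (K : Type*) {V : Type*} [Field K] [AddCommGroup V] [Module K V]
    (E : Finset V) (I : Set V) :
    (vectorMatroid K E).Indep I ↔ I ⊆ (E : Set V) ∧ LinearIndepOn K id I := Iff.rfl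

/-- A matroid is regular if it is represented over `ℝ` by a totally unimodular matrix: the columns
of the matrix are indexed by the ground set, and a subset of the ground set is independent exactly
when the corresponding family of columns is linearly independent. -/
def IsRegularMatroid {α : Type*} (M : Matroid α) : Prop :=
  ∃ (m : ℕ) (A : Matrix (Fin m) M.E ℝ), A.IsTotallyUnimodular ∧
    ∀ I : Set M.E, M.Indep (Subtype.val '' I) ↔ LinearIndepOn ℝ A.col I

end Matroids

/-! ### The poset of regular submatroids of full rank -/

section Poset

/-- `IR r` is the poset of all subsets of `F₂ʳ ∖ {0}` which are, with linear independence over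
`F₂`, regular matroids of rank `r`. It is ordered by inclusion. -/
def IR (r : ℕ) : Type :=
  {E : Finset (Fin r → ZMod 2) // (0 : Fin r → ZMod 2) ∉ E ∧
    IsRegularMatroid (vectorMatroid (ZMod 2) E) ∧ (vectorMatroid (ZMod 2) E).eRank = r}

instance (r : ℕ) : PartialOrder (IR r) :=
  inferInstanceAs (PartialOrder {E : Finset (Fin r → ZMod 2) // (0 : Fin r → ZMod 2) ∉ E ∧
    IsRegularMatroid (vectorMatroid (ZMod 2) E) ∧ (vectorMatroid (ZMod 2) E).eRank = r})

instance (r : ℕ) : Finite (IR r) :=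
  inferInstanceAs (Finite {E : Finset (Fin r → ZMod 2) // (0 : Fin r → ZMod 2) ∉ E ∧
    IsRegularMatroid (vectorMatroid (ZMod 2) E) ∧ (vectorMatroid (ZMod 2) E).eRank = r})

noncomputable instance (r : ℕ) : Fintype (IR r) := Fintype.ofFinite _

/-- The geometric realization of a finite poset `P`, that is, of the simplicial complex whose
`k`-simplices are the chains `x₀ < x₁ < ⋯ < xₖ` in `P`. In barycentric coordinates a point is a
family of nonnegative weights with sum `1` whose support is a chain. -/
def posetRealization (P : Type*) [PartialOrder P] [Fintype P] : Set (P → ℝ) :=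
  {w | w ∈ stdSimplex ℝ P ∧ IsChain (· ≤ ·) (Function.support w)}

end Poset

/-! ### Wedges of spheres -/

section Wedges

/-- The wedge of a nonempty family of pointed spaces: the quotient of the disjoint union that
identifies all the base points with one another. -/
def Wedge {ι : Type*} [Nonempty ι] (X : ι → Type*) (x₀ : ∀ i, X i) : Type _ :=
  Quot (fun a b : (Σ i, X i) => a.2 = x₀ a.1 ∧ b.2 = x₀ b.1)

instance {ι : Type*} [Nonempty ι] (X : ι → Type*) [∀ i, TopologicalSpace (X i)]
    (x₀ : ∀ i, X i) : TopologicalSpace (Wedge X x₀) :=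
  inferInstanceAs (TopologicalSpace (Quot _))

/-- The unit sphere `Sⁿ` in `ℝⁿ⁺¹`. -/
abbrev unitSphere (n : ℕ) : Type :=
  sphere (0 : EuclideanSpace ℝ (Fin (n + 1))) 1

/-- The base point `(1, 0, …, 0)` of `Sⁿ`. -/
noncomputable def sphereBase (n : ℕ) : unitSphere n :=
  ⟨EuclideanSpace.single 0 1, by simp⟩

/-- The wedge of `k` copies of `Sⁿ`, for `k ≥ 1`. -/
abbrev WedgeOfSpheres (k n : ℕ) [NeZero k] : Type :=
  Wedge (fun _ : Fin k => unitSphere n) (fun _ => sphereBase n)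

end Wedges

/-! A set of nonzero vectors of F₂³ is regular of rank 3 exactly when it spans and is not the whole
Fano plane. The Fano matroid has no real representation
(`not_isRegularMatroid_of_forall_fanoPoint_mem`), while a spanning set that misses a point lifts to
a totally unimodular matrix (`isRegularMatroid_of_notMem`). A set fails to span when it lies on a
line, so complementation turns the poset upside down into the nonempty faces of the complex Δ of
those sets of points that contain no complement of a line. This is the independence complex of the
dual Fano matroid. By barycentric subdivision (`nonempty_homeomorph_complexRealization`) the two
realizations are homeomorphic.

Δ is nearly a cone with apex 6: a face can be joined to 6 unless it contains one of the four
triangles left by deleting 6 from a line complement through 6. Each such triangle lies in three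
tetrahedra of Δ. Remove two of the three for each triangle, eight tetrahedra in all. Every triangle
is then a free face of its third tetrahedron; after the four collapses a cone remains. So Δ is a
contractible subcomplex A with eight 3-cells attached.

Collapsing A yields a wedge of eight 3-spheres, and it is a homotopy equivalence
(`IsFacetFamily.nonempty_homotopyEquiv`): the contraction of A extends to Δ by pushing the points of
a cell radially outwards and letting those that reach A follow the contraction. -/

/-! ### The sphere as a simplex with collapsed boundary. -/

section SimplexSphere

/-- The least coordinate of a vector with at least one coordinate. -/
noncomputable def minCoord {n : ℕ} (y : Fin (n + 1) → ℝ) : ℝ :=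
  Finset.univ.inf' Finset.univ_nonempty y

theorem continuous_minCoord {n : ℕ} : Continuous (minCoord (n := n)) :=
  Continuous.finset_inf'_apply _ fun i _ => continuous_apply i

theorem minCoord_le {n : ℕ} (y : Fin (n + 1) → ℝ) (j : Fin (n + 1)) : minCoord y ≤ y j :=
  Finset.inf'_le _ (Finset.mem_univ j)

theorem exists_eq_minCoord {n : ℕ} (y : Fin (n + 1) → ℝ) : ∃ j, y j = minCoord y := by
  obtain ⟨j, -, hj⟩ := Finset.exists_mem_eq_inf' Finset.univ_nonempty y
  exact ⟨j, hj.symm⟩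

theorem le_minCoord_iff {n : ℕ} (y : Fin (n + 1) → ℝ) (c : ℝ) :
    c ≤ minCoord y ↔ ∀ j, c ≤ y j := by
  simp [minCoord]

theorem minCoord_pos_iff {n : ℕ} (y : Fin (n + 1) → ℝ) : 0 < minCoord y ↔ ∀ j, 0 < y j := by
  simp [minCoord]

theorem minCoord_add_const {n : ℕ} (y : Fin (n + 1) → ℝ) (c : ℝ) :
    minCoord (fun j => y j + c) = minCoord y + c := by
  obtain ⟨j, hj⟩ := exists_eq_minCoord y
  refine le_antisymm ((minCoord_le _ j).trans_eq (by rw [hj])) ?_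
  rw [le_minCoord_iff]
  intro i
  linarith [minCoord_le y i]

theorem minCoord_const_mul {n : ℕ} (y : Fin (n + 1) → ℝ) {c : ℝ} (hc : 0 ≤ c) :
    minCoord (fun j => c * y j) = c * minCoord y := by
  obtain ⟨j, hj⟩ := exists_eq_minCoord y
  refine le_antisymm ((minCoord_le _ j).trans_eq (by rw [hj])) ?_
  rw [le_minCoord_iff]
  intro i
  exact mul_le_mul_of_nonneg_left (minCoord_le y i) hc

theorem minCoord_nonneg {n : ℕ} {y : Fin (n + 1) → ℝ} (hy : ∀ j, 0 ≤ y j) : 0 ≤ minCoord y :=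
  (le_minCoord_iff y 0).2 hy

/-- The sum of the squares of the differences between the coordinates and the first one. -/
noncomputable def sqDiff {n : ℕ} (y : Fin (n + 1) → ℝ) : ℝ :=
  ∑ j : Fin n, (y j.succ - y 0) ^ 2

theorem sqDiff_nonneg {n : ℕ} (y : Fin (n + 1) → ℝ) : 0 ≤ sqDiff y :=
  Finset.sum_nonneg fun _ _ => sq_nonneg _

/-- The denominator of the stereographic formulas could vanish only if all coordinates were equal
with minimum zero, against their sum being 1. -/
theorem sqDiff_add_sq_pos {n : ℕ} {y : Fin (n + 1) → ℝ} (hy : y ∈ stdSimplex ℝ (Fin (n + 1))) :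
    0 < sqDiff y + minCoord y ^ 2 := by
  have h0 := sqDiff_nonneg y
  by_contra hcon
  have h1 : sqDiff y = 0 := by nlinarith [sq_nonneg (minCoord y)]
  have h2 : minCoord y = 0 := by
    have : minCoord y ^ 2 ≤ 0 := by linarith
    exact pow_eq_zero_iff two_ne_zero |>.1 (le_antisymm this (sq_nonneg _))
  have h3 : ∀ j, y j = y 0 := by
    intro j
    refine Fin.cases rfl (fun j => ?_) j
    have := (Finset.sum_eq_zero_iff_of_nonneg (fun _ _ => sq_nonneg _)).1 h1 j (Finset.mem_univ _)
    have := pow_eq_zero_iff two_ne_zero |>.1 this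
    linarith
  obtain ⟨j, hj⟩ := exists_eq_minCoord y
  have h4 : ∀ i, y i = 0 := fun i => by rw [h3 i, ← h3 j, hj, h2]
  have := hy.2
  simp [h4] at this

/-- The map from a simplex to a sphere which collapses the boundary of the simplex to the base
point: the inverse of stereographic projection after a radial homeomorphism from the interior of
the simplex to a Euclidean space. -/
noncomputable def simplexToSphereFun {n : ℕ} (y : Fin (n + 1) → ℝ) :
    EuclideanSpace ℝ (Fin (n + 1)) :=
  -- Inverse stereographic projection of the vector of ratios (y_{j+1} - y_0) / min y, with
  -- denominators cleared so that the formula survives on the boundary, where min y = 0.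
  WithLp.toLp 2 (Fin.cons ((sqDiff y - minCoord y ^ 2) / (sqDiff y + minCoord y ^ 2))
    fun j => 2 * minCoord y * (y j.succ - y 0) / (sqDiff y + minCoord y ^ 2))

theorem simplexToSphereFun_zero {n : ℕ} (y : Fin (n + 1) → ℝ) :
    simplexToSphereFun y 0 = (sqDiff y - minCoord y ^ 2) / (sqDiff y + minCoord y ^ 2) := rfl

theorem simplexToSphereFun_succ {n : ℕ} (y : Fin (n + 1) → ℝ) (j : Fin n) :
    simplexToSphereFun y j.succ =
      2 * minCoord y * (y j.succ - y 0) / (sqDiff y + minCoord y ^ 2) := rfl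

theorem mem_unitSphere_iff {n : ℕ} (p : EuclideanSpace ℝ (Fin (n + 1))) :
    p ∈ sphere (0 : EuclideanSpace ℝ (Fin (n + 1))) 1 ↔ p 0 ^ 2 + ∑ j : Fin n, p j.succ ^ 2 = 1 := by
  rw [mem_sphere_zero_iff_norm, EuclideanSpace.norm_eq, Real.sqrt_eq_one, Fin.sum_univ_succ]
  simp

theorem simplexToSphereFun_mem {n : ℕ} {y : Fin (n + 1) → ℝ}
    (hy : y ∈ stdSimplex ℝ (Fin (n + 1))) :
    simplexToSphereFun y ∈ sphere (0 : EuclideanSpace ℝ (Fin (n + 1))) 1 := by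
  have hpos := sqDiff_add_sq_pos hy
  have hsum : ∑ j : Fin n, (2 * minCoord y * (y j.succ - y 0) / (sqDiff y + minCoord y ^ 2)) ^ 2 =
      4 * minCoord y ^ 2 * sqDiff y / (sqDiff y + minCoord y ^ 2) ^ 2 := by
    rw [sqDiff, Finset.mul_sum, Finset.sum_div]
    exact Finset.sum_congr rfl fun j _ => by rw [div_pow]; ring
  rw [mem_unitSphere_iff]
  simp only [simplexToSphereFun_zero, simplexToSphereFun_succ]
  rw [hsum]
  field_simp
  ring

theorem continuousOn_simplexToSphereFun {n : ℕ} :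
    ContinuousOn (simplexToSphereFun (n := n)) (stdSimplex ℝ (Fin (n + 1))) := by
  have h1 := continuous_minCoord (n := n)
  have h2 : Continuous (sqDiff (n := n)) := by unfold sqDiff; fun_prop
  refine (PiLp.continuous_toLp 2 _).comp_continuousOn (continuousOn_pi.2 fun i => ?_)
  refine Fin.cases ?_ (fun j => ?_) i
  · exact ContinuousOn.div (by fun_prop) (by fun_prop) fun y hy => (sqDiff_add_sq_pos hy).ne'
  · exact ContinuousOn.div (by fun_prop) (by fun_prop) fun y hy => (sqDiff_add_sq_pos hy).ne'

/-- The map from the standard simplex to the sphere of the same dimension which collapses the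
boundary to the base point. -/
noncomputable def simplexToSphere (n : ℕ) : C(stdSimplex ℝ (Fin (n + 1)), unitSphere n) where
  toFun y := ⟨simplexToSphereFun y.1, simplexToSphereFun_mem y.2⟩
  continuous_toFun := Continuous.subtype_mk
    (continuousOn_iff_continuous_domRestrict.1 continuousOn_simplexToSphereFun) _

theorem simplexToSphere_apply {n : ℕ} (y : stdSimplex ℝ (Fin (n + 1))) (i : Fin (n + 1)) :
    (simplexToSphere n y).1 i = simplexToSphereFun y.1 i := rfl

theorem minCoord_nonneg_of_mem {n : ℕ} {y : Fin (n + 1) → ℝ}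
    (hy : y ∈ stdSimplex ℝ (Fin (n + 1))) : 0 ≤ minCoord y :=
  minCoord_nonneg hy.1

theorem simplexToSphere_eq_base_iff {n : ℕ} (y : stdSimplex ℝ (Fin (n + 1))) :
    simplexToSphere n y = sphereBase n ↔ minCoord y.1 = 0 := by
  have hpos := sqDiff_add_sq_pos y.2
  constructor
  · intro h
    have h0 : simplexToSphereFun y.1 0 = 1 := by
      rw [← simplexToSphere_apply, h]
      simp [sphereBase]
    rw [simplexToSphereFun_zero, div_eq_one_iff_eq hpos.ne'] at h0
    have : minCoord y.1 ^ 2 = 0 := by linarith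
    exact pow_eq_zero_iff two_ne_zero |>.1 this
  · intro h
    apply Subtype.ext
    ext i
    refine Fin.cases ?_ (fun j => ?_) i
    · rw [simplexToSphere_apply, simplexToSphereFun_zero, h]
      rw [h] at hpos
      rw [zero_pow two_ne_zero, add_zero] at hpos ⊢
      rw [sub_zero, div_self hpos.ne']
      simp [sphereBase]
    · rw [simplexToSphere_apply, simplexToSphereFun_succ, h]
      simp [sphereBase]

theorem simplexToSphere_injOn {n : ℕ} {y z : stdSimplex ℝ (Fin (n + 1))}
    (h : simplexToSphere n y = simplexToSphere n z) (hy : minCoord y.1 ≠ 0) : y = z := by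
  have hz : minCoord z.1 ≠ 0 := by
    rwa [Ne, ← simplexToSphere_eq_base_iff, ← h, simplexToSphere_eq_base_iff]
  have hpy := sqDiff_add_sq_pos y.2
  have hpz := sqDiff_add_sq_pos z.2
  have sy : 0 < minCoord y.1 := (minCoord_nonneg_of_mem y.2).lt_of_ne' hy
  have sz : 0 < minCoord z.1 := (minCoord_nonneg_of_mem z.2).lt_of_ne' hz
  have hc : ∀ i, simplexToSphereFun y.1 i = simplexToSphereFun z.1 i := fun i =>
    congrArg (fun p : unitSphere n => p.1 i) h
  have h0 := hc 0
  rw [simplexToSphereFun_zero, simplexToSphereFun_zero] at h0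
  have hq : minCoord y.1 ^ 2 / (sqDiff y.1 + minCoord y.1 ^ 2) =
      minCoord z.1 ^ 2 / (sqDiff z.1 + minCoord z.1 ^ 2) := by
    rw [div_eq_div_iff hpy.ne' hpz.ne'] at h0 ⊢
    linarith
  have hdir : ∀ j : Fin n, (y.1 j.succ - y.1 0) / minCoord y.1 =
      (z.1 j.succ - z.1 0) / minCoord z.1 := by
    intro j
    have hj := hc j.succ
    rw [simplexToSphereFun_succ, simplexToSphereFun_succ] at hj
    have e1 : 2 * minCoord y.1 * (y.1 j.succ - y.1 0) / (sqDiff y.1 + minCoord y.1 ^ 2) =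
        2 * (minCoord y.1 ^ 2 / (sqDiff y.1 + minCoord y.1 ^ 2)) *
          ((y.1 j.succ - y.1 0) / minCoord y.1) := by field_simp
    have e2 : 2 * minCoord z.1 * (z.1 j.succ - z.1 0) / (sqDiff z.1 + minCoord z.1 ^ 2) =
        2 * (minCoord z.1 ^ 2 / (sqDiff z.1 + minCoord z.1 ^ 2)) *
          ((z.1 j.succ - z.1 0) / minCoord z.1) := by field_simp
    rw [e1, e2, hq] at hj
    have : 2 * (minCoord z.1 ^ 2 / (sqDiff z.1 + minCoord z.1 ^ 2)) ≠ 0 := by positivity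
    exact mul_left_cancel₀ this hj
  -- The rescaled points y / min y and z / min z differ by the constant c. Both have least
  -- coordinate 1, so c = 0; the coordinate sums then give equal scales.
  set c : ℝ := y.1 0 / minCoord y.1 - z.1 0 / minCoord z.1 with hcdef
  have hall : ∀ j, (minCoord y.1)⁻¹ * y.1 j = (minCoord z.1)⁻¹ * z.1 j + c := by
    intro j
    refine Fin.cases ?_ (fun j => ?_) j
    · rw [hcdef]; ring
    · have := hdir j
      rw [sub_div, sub_div] at this
      rw [hcdef, inv_mul_eq_div, inv_mul_eq_div]
      linarith
  have hmin : (1 : ℝ) = 1 + c := by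
    have e1 := minCoord_const_mul y.1 (inv_nonneg.2 sy.le)
    have e2 := minCoord_const_mul z.1 (inv_nonneg.2 sz.le)
    rw [funext hall, minCoord_add_const, e2, inv_mul_cancel₀ hy, inv_mul_cancel₀ hz] at e1
    exact e1.symm
  have hc0 : c = 0 := by linarith
  have hsum : (minCoord y.1)⁻¹ = (minCoord z.1)⁻¹ := by
    have := Finset.sum_congr (s₁ := Finset.univ) rfl fun j _ => hall j
    simpa [hc0, ← Finset.mul_sum, y.2.2, z.2.2] using this
  apply Subtype.ext
  funext j
  have := hall j
  rw [hsum, hc0, add_zero] at this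
  exact mul_left_cancel₀ (inv_ne_zero hz) this

theorem simplexToSphere_surjective {n : ℕ} (hn : n ≠ 0) :
    Function.Surjective (simplexToSphere n) := by
  intro p
  by_cases hp : p.1 0 = 1
  · refine ⟨⟨Pi.single 0 1, single_mem_stdSimplex ℝ 0⟩, ?_⟩
    have hbase : p = sphereBase n := by
      have h1 := (mem_unitSphere_iff p.1).1 p.2
      rw [hp] at h1
      have h2 : ∑ j : Fin n, p.1 j.succ ^ 2 = 0 := by linarith
      rw [Finset.sum_eq_zero_iff_of_nonneg fun _ _ => sq_nonneg _] at h2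
      apply Subtype.ext
      ext i
      refine Fin.cases ?_ (fun j => ?_) i
      · simp [sphereBase, hp]
      · have := pow_eq_zero_iff two_ne_zero |>.1 (h2 j (Finset.mem_univ _))
        simp [sphereBase, this]
    rw [hbase, simplexToSphere_eq_base_iff]
    refine le_antisymm ((minCoord_le _ (Fin.last n)).trans_eq ?_) (minCoord_nonneg ?_)
    -- A vertex has a vanishing coordinate only for n ≥ 1. For n = 0 the simplex is one point, which
    -- misses the base point.
    · have : Fin.last n ≠ 0 := by
        intro h
        exact hn (by simpa using congrArg Fin.val h)
      simp [this]
    · exact (single_mem_stdSimplex ℝ (0 : Fin (n + 1))).1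
  · have h1 := (mem_unitSphere_iff p.1).1 p.2
    set q := p.1 0 with hq
    have hq1 : q < 1 := by
      have : 0 ≤ ∑ j : Fin n, p.1 j.succ ^ 2 := Finset.sum_nonneg fun _ _ => sq_nonneg _
      refine lt_of_le_of_ne ?_ hp
      nlinarith
    -- The stereographic image of `p`, preceded by 0. Translating it to minimum 1 makes it a vector
    -- with the prescribed ratios of differences to minimum; scaling to sum 1 keeps them.
    let z : Fin (n + 1) → ℝ := Fin.cons 0 fun j => p.1 j.succ / (1 - q)
    let y : Fin (n + 1) → ℝ := fun j => z j + (1 - minCoord z)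
    have hmy : minCoord y = 1 := by
      rw [minCoord_add_const]; ring
    have hy1 : ∀ j, 1 ≤ y j := fun j => hmy ▸ minCoord_le y j
    have hs : 0 < ∑ j, y j :=
      Finset.sum_pos (fun j _ => lt_of_lt_of_le one_pos (hy1 j)) Finset.univ_nonempty
    set s : ℝ := ∑ j, y j
    let x : Fin (n + 1) → ℝ := fun j => s⁻¹ * y j
    have hx : x ∈ stdSimplex ℝ (Fin (n + 1)) := by
      refine ⟨fun j => mul_nonneg (inv_nonneg.2 hs.le) (zero_le_one.trans (hy1 j)), ?_⟩
      rw [← Finset.mul_sum]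
      exact inv_mul_cancel₀ hs.ne'
    have hmx : minCoord x = s⁻¹ := by
      rw [minCoord_const_mul y (inv_nonneg.2 hs.le), hmy, mul_one]
    have hdx : ∀ j : Fin n, x j.succ - x 0 = s⁻¹ * (p.1 j.succ / (1 - q)) := by
      intro j
      simp only [x, y, z, Fin.cons_succ, Fin.cons_zero]
      ring
    have h1q : 1 - q ≠ 0 := by linarith
    have hN : sqDiff x = s⁻¹ ^ 2 * ((1 + q) / (1 - q)) := by
      have : ∑ j : Fin n, p.1 j.succ ^ 2 = (1 - q) * (1 + q) := by linarith
      simp only [sqDiff, hdx]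
      have e : ∀ j : Fin n, (s⁻¹ * (p.1 j.succ / (1 - q))) ^ 2 =
          (s⁻¹ ^ 2 / (1 - q) ^ 2) * p.1 j.succ ^ 2 := fun j => by
        rw [mul_pow, div_pow]; ring
      simp only [e, ← Finset.mul_sum, this]
      field_simp
    have hden : sqDiff x + minCoord x ^ 2 = s⁻¹ ^ 2 * (2 / (1 - q)) := by
      rw [hN, hmx]
      field_simp
      ring
    refine ⟨⟨x, hx⟩, Subtype.ext ?_⟩
    ext i
    refine Fin.cases ?_ (fun j => ?_) i
    · change simplexToSphereFun x 0 = q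
      rw [simplexToSphereFun_zero, hden, hN, hmx]
      field_simp
      ring
    · change simplexToSphereFun x j.succ = p.1 j.succ
      rw [simplexToSphereFun_succ, hden, hdx, hmx]
      field_simp

end SimplexSphere

/-! ### Quotient maps that are homotopy equivalences; points of a wedge. -/

section QuotientMaps

open Topology unitInterval

/-- A quotient map is a homotopy equivalence if the identity is homotopic, through maps respecting
its fibres, to a map which is constant on each fibre. -/
theorem Topology.IsQuotientMap.nonempty_homotopyEquiv {X W : Type*} [TopologicalSpace X]
    [TopologicalSpace W] {f : X → W} (hf : IsQuotientMap f) {h : I × X → X} (hc : Continuous h)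
    (h0 : ∀ x, h (0, x) = x) (hfib : ∀ t x y, f x = f y → f (h (t, x)) = f (h (t, y)))
    (h1 : ∀ x y, f x = f y → h (1, x) = h (1, y)) :
    Nonempty (ContinuousMap.HomotopyEquiv X W) := by
  let r : W → X := Function.surjInv hf.surjective
  have hr : ∀ w, f (r w) = w := Function.surjInv_eq hf.surjective
  let g : W → X := fun w => h (1, r w)
  have hgf : ∀ x, g (f x) = h (1, x) := fun x => h1 _ _ (hr _)
  have hg : Continuous g := by
    rw [hf.continuous_iff]
    have : g ∘ f = fun x => h (1, x) := funext hgf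
    rw [this]
    fun_prop
  let H : I × W → W := fun p => f (h (p.1, r p.2))
  have hH : Continuous H := by
    -- The unit interval is locally compact, so its product with a quotient map is again a quotient
    -- map.
    refine hf.continuous_lift_prod_right ?_
    have : (fun p : I × X => H (p.1, f p.2)) = fun p => f (h p) :=
      funext fun p => hfib _ _ _ (hr _)
    rw [this]
    exact hf.continuous.comp hc
  exact ⟨{
    toFun := ⟨f, hf.continuous⟩
    invFun := ⟨g, hg⟩
    left_inv := ⟨ContinuousMap.Homotopy.symm
      { toFun := h
        continuous_toFun := hc
        map_zero_left := h0
        map_one_left := fun x => (hgf x).symm }⟩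
    right_inv := ⟨ContinuousMap.Homotopy.symm
      { toFun := H
        continuous_toFun := hH
        map_zero_left := fun w => by simp only [H, h0, hr]; rfl
        map_one_left := fun w => rfl }⟩ }⟩

/-- The point of a wedge given by a point of one of its summands. -/
def Wedge.mk {ι : Type*} [Nonempty ι] {X : ι → Type*} (x₀ : ∀ i, X i) (a : Σ i, X i) :
    Wedge X x₀ :=
  Quot.mk _ a

theorem Wedge.isQuotientMap_mk {ι : Type*} [Nonempty ι] {X : ι → Type*}
    [∀ i, TopologicalSpace (X i)] (x₀ : ∀ i, X i) : IsQuotientMap (Wedge.mk x₀) :=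
  isQuotientMap_quot_mk

/-- The gluing relation together with equality is already an equivalence relation. -/
theorem Wedge.mk_eq_mk_iff {ι : Type*} [Nonempty ι] {X : ι → Type*} {x₀ : ∀ i, X i}
    (a b : Σ i, X i) :
    Wedge.mk x₀ a = Wedge.mk x₀ b ↔ a = b ∨ (a.2 = x₀ a.1 ∧ b.2 = x₀ b.1) := by
  refine ⟨fun h => ?_, ?_⟩
  · have := Quot.eqvGen_exact h
    clear h
    induction this with
    | rel x y h => exact Or.inr h
    | refl x => exact Or.inl rfl
    | symm x y _ ih => exact ih.imp Eq.symm And.symm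
    | trans x y z _ _ ih1 ih2 =>
      rcases ih1 with rfl | ih1
      · exact ih2
      · rcases ih2 with rfl | ih2
        · exact Or.inr ih1
        · exact Or.inr ⟨ih1.1, ih2.2⟩
  · rintro (rfl | h)
    · rfl
    · exact Quot.sound h

end QuotientMaps

/-! ### Realizations of finite simplicial complexes. -/

section Realization

variable {ι : Type*} [Fintype ι]

/-- The set of the vertices at which a vector of barycentric coordinates does not vanish. -/
noncomputable def vertexSupport (x : ι → ℝ) : Finset ι := Finset.univ.filter fun i => x i ≠ 0

theorem mem_vertexSupport {x : ι → ℝ} {i : ι} : i ∈ vertexSupport x ↔ x i ≠ 0 := by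
  simp [vertexSupport]

theorem notMem_vertexSupport {x : ι → ℝ} {i : ι} : i ∉ vertexSupport x ↔ x i = 0 := by
  simp [vertexSupport]

/-- The geometric realization, in barycentric coordinates, of the simplicial complex whose faces
are the members of a family `K` of finite sets. -/
def complexRealization (K : Set (Finset ι)) : Set (ι → ℝ) :=
  {x | x ∈ stdSimplex ℝ ι ∧ vertexSupport x ∈ K}

theorem complexRealization_mem_of_subset {K : Set (Finset ι)} (hK : IsLowerSet K) {x y : ι → ℝ}
    (hx : x ∈ complexRealization K) (hy : y ∈ stdSimplex ℝ ι) (h : ∀ i, x i = 0 → y i = 0) :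
    y ∈ complexRealization K := by
  refine ⟨hy, hK (fun i hi => ?_) hx.2⟩
  rw [mem_vertexSupport] at hi ⊢
  exact fun h0 => hi (h i h0)

/-- The realization is a finite union of closed faces. Compactness later turns continuous
surjections into quotient maps. -/
theorem isCompact_complexRealization {K : Set (Finset ι)} (hK : IsLowerSet K) :
    IsCompact (complexRealization K) := by
  have : complexRealization K =
      ⋃ F ∈ K, stdSimplex ℝ ι ∩ ⋂ i ∈ (Fᶜ : Set (ι)), {x : ι → ℝ | x i = 0} := by
    ext x
    simp only [Set.mem_iUnion, Set.mem_inter_iff, Set.mem_iInter]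
    constructor
    · intro hx
      refine ⟨_, hx.2, hx.1, fun i hi => ?_⟩
      exact notMem_vertexSupport.1 (by simpa using hi)
    · rintro ⟨F, hF, hx, h⟩
      refine ⟨hx, hK (fun i hi => ?_) hF⟩
      by_contra hiF
      exact mem_vertexSupport.1 hi (h i (by simpa using hiF))
  rw [this]
  refine (Set.toFinite K).isCompact_biUnion fun F _ => ?_
  refine (isCompact_stdSimplex ℝ ι).inter_right (isClosed_biInter fun i _ => ?_)
  exact isClosed_eq (continuous_apply i) continuous_const

end Realization

/-! ### Facets as open cells with a radial coordinate. -/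

section Cells

variable {ι κ : Type*} {n : ℕ}

/-- A family of pairwise distinct maximal faces with `n + 1` vertices each. -/
structure IsFacetFamily (K : Set (Finset ι)) (m : κ → Fin (n + 1) ↪ ι) : Prop where
  mem : ∀ a, Finset.univ.map (m a) ∈ K
  maximal : ∀ a, ∀ F ∈ K, Finset.univ.map (m a) ⊆ F → F = Finset.univ.map (m a)
  injective : Function.Injective fun a => Finset.univ.map (m a)

/-- The family of faces without some given ones. -/
def removeFacets (K : Set (Finset ι)) (m : κ → Fin (n + 1) ↪ ι) : Set (Finset ι) :=
  {F | F ∈ K ∧ ∀ a, F ≠ Finset.univ.map (m a)}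

/-- The cone parameter of the point with coordinates `x` in a simplex, viewed as the cone over its
boundary with the barycentre as apex. -/
noncomputable def coneParam (e : Fin (n + 1) ↪ ι) (x : ι → ℝ) : ℝ :=
  (n + 1) * minCoord (x ∘ e)

theorem continuous_coneParam (e : Fin (n + 1) ↪ ι) : Continuous (coneParam e) := by
  have := continuous_minCoord (n := n)
  unfold coneParam
  fun_prop

/-- The barycentre of a simplex. -/
noncomputable def cellCenter (e : Fin (n + 1) ↪ ι) (i : ι) : ℝ :=
  open Classical in if i ∈ Finset.univ.map e then 1 / ((n : ℝ) + 1) else 0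

theorem cellCenter_apply (e : Fin (n + 1) ↪ ι) (j : Fin (n + 1)) :
    cellCenter e (e j) = 1 / ((n : ℝ) + 1) := by
  simp [cellCenter]

theorem cellCenter_of_notMem (e : Fin (n + 1) ↪ ι) {i : ι} (hi : i ∉ Finset.univ.map e) :
    cellCenter e i = 0 := by
  classical
  exact if_neg hi

variable {K : Set (Finset ι)} {m : κ → Fin (n + 1) ↪ ι}

theorem IsFacetFamily.isLowerSet_removeFacets (hm : IsFacetFamily K m) (hK : IsLowerSet K) :
    IsLowerSet (removeFacets K m) := by
  intro F G hGF hF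
  refine ⟨hK hGF hF.1, fun a ha => ?_⟩
  exact hF.2 a (hm.maximal a F hF.1 (ha ▸ hGF))

variable [Fintype ι]

theorem coneParam_nonneg (e : Fin (n + 1) ↪ ι) {x : ι → ℝ} (hx : x ∈ stdSimplex ℝ ι) :
    0 ≤ coneParam e x :=
  mul_nonneg (by positivity) (minCoord_nonneg fun j => hx.1 _)

theorem coneParam_pos_iff (e : Fin (n + 1) ↪ ι) {x : ι → ℝ} (hx : x ∈ stdSimplex ℝ ι) :
    0 < coneParam e x ↔ Finset.univ.map e ⊆ vertexSupport x := by
  unfold coneParam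
  rw [mul_pos_iff_of_pos_left (by positivity), minCoord_pos_iff]
  constructor
  · intro h i hi
    obtain ⟨j, -, rfl⟩ := Finset.mem_map.1 hi
    exact mem_vertexSupport.2 (h j).ne'
  · intro h j
    exact (hx.1 _).lt_of_ne' (mem_vertexSupport.1 (h (Finset.mem_map_of_mem e (Finset.mem_univ j))))

theorem sum_cellCenter (e : Fin (n + 1) ↪ ι) : ∑ i, cellCenter e i = 1 := by
  classical
  have h : ∑ i, cellCenter e i = ∑ i ∈ Finset.univ.map e, cellCenter e i :=
    (Finset.sum_subset (Finset.subset_univ _) fun i _ hi => cellCenter_of_notMem e hi).symm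
  rw [h, Finset.sum_map]
  simp only [cellCenter_apply, Finset.sum_const, Finset.card_univ, Fintype.card_fin, nsmul_eq_mul]
  push_cast
  field_simp

theorem coneParam_mul_cellCenter_le (e : Fin (n + 1) ↪ ι) {x : ι → ℝ} (hx : x ∈ stdSimplex ℝ ι)
    (i : ι) : coneParam e x * cellCenter e i ≤ x i := by
  by_cases hi : i ∈ Finset.univ.map e
  · obtain ⟨j, -, rfl⟩ := Finset.mem_map.1 hi
    rw [cellCenter_apply, coneParam]
    have := minCoord_le (x ∘ e) j
    have hn : (n : ℝ) + 1 ≠ 0 := by positivity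
    field_simp
    exact this
  · rw [cellCenter_of_notMem e hi, mul_zero]
    exact hx.1 i

theorem IsFacetFamily.coneParam_pos_iff (hm : IsFacetFamily K m) {x : ι → ℝ}
    (hx : x ∈ complexRealization K) (a : κ) :
    0 < coneParam (m a) x ↔ vertexSupport x = Finset.univ.map (m a) := by
  rw [_root_.coneParam_pos_iff _ hx.1]
  exact ⟨hm.maximal a _ hx.2, fun h => h.ge⟩

/-- Open cells of distinct facets are disjoint. Hence sums over the family, as in `stretchWeight`,
have at most one nonzero term. -/
theorem IsFacetFamily.coneParam_eq_zero (hm : IsFacetFamily K m) {x : ι → ℝ}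
    (hx : x ∈ complexRealization K) {a b : κ} (ha : 0 < coneParam (m a) x) (hab : b ≠ a) :
    coneParam (m b) x = 0 := by
  by_contra h
  have hb := (coneParam_nonneg (m b) hx.1).lt_of_ne' h
  rw [hm.coneParam_pos_iff hx] at ha hb
  exact hab (hm.injective (hb.symm.trans ha))

theorem mem_removeFacets_iff (hm : IsFacetFamily K m) {x : ι → ℝ}
    (hx : x ∈ complexRealization K) :
    x ∈ complexRealization (removeFacets K m) ↔ ∀ a, coneParam (m a) x = 0 := by
  constructor
  · intro h a
    by_contra h0
    have := (coneParam_nonneg (m a) hx.1).lt_of_ne' h0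
    rw [hm.coneParam_pos_iff hx] at this
    exact h.2.2 a this
  · intro h
    refine ⟨hx.1, hx.2, fun a ha => ?_⟩
    rw [← hm.coneParam_pos_iff hx, h a] at ha
    exact lt_irrefl _ ha

theorem complexRealization_removeFacets_subset :
    complexRealization (removeFacets K m) ⊆ complexRealization K :=
  fun _ hx => ⟨hx.1, hx.2.1⟩

end Cells

/-! ### Collapsing a contractible subcomplex. -/

section Stretch

open Topology unitInterval

variable {ι κ : Type*} {n : ℕ} [Fintype κ] {m : κ → Fin (n + 1) ↪ ι}

/-- The total weight which the stretching homotopy takes away from the barycentres at time `t`. -/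
noncomputable def stretchWeight (m : κ → Fin (n + 1) ↪ ι) (t : ℝ) (x : ι → ℝ) : ℝ :=
  ∑ a, min (coneParam (m a) x) (t / 2)

/-- The homotopy which stretches the cells radially outwards over the whole complex. -/
noncomputable def stretch (m : κ → Fin (n + 1) ↪ ι) (t : ℝ) (x : ι → ℝ) : ι → ℝ := fun i =>
  -- In a cell, x = λc + (1 - λ)b with barycentre c and boundary point b. The weight min(λ, t/2) of
  -- c is removed and the rest renormalized; for t ≤ 1 the cap keeps the denominator at least 1/2.
  (x i - ∑ a, min (coneParam (m a) x) (t / 2) * cellCenter (m a) i) / (1 - stretchWeight m t x)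

theorem stretch_of_eq_zero {t : ℝ} (ht : 0 ≤ t) {x : ι → ℝ}
    (h : ∀ a, coneParam (m a) x = 0) : stretch m t x = x := by
  have : min 0 (t / 2) = 0 := min_eq_left (by linarith)
  funext i
  simp [stretch, stretchWeight, h, this]

variable [Fintype ι] {K : Set (Finset ι)}

theorem IsFacetFamily.stretchWeight_of_pos (hm : IsFacetFamily K m) {t : ℝ} (ht : 0 ≤ t)
    {x : ι → ℝ} (hx : x ∈ complexRealization K) {a : κ} (ha : 0 < coneParam (m a) x) :
    stretchWeight m t x = min (coneParam (m a) x) (t / 2) := by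
  refine Finset.sum_eq_single a (fun b _ hb => ?_) (by simp)
  rw [hm.coneParam_eq_zero hx ha hb]
  exact min_eq_left (by linarith)

theorem IsFacetFamily.stretch_of_pos (hm : IsFacetFamily K m) {t : ℝ} (ht : 0 ≤ t)
    {x : ι → ℝ} (hx : x ∈ complexRealization K) {a : κ} (ha : 0 < coneParam (m a) x) (i : ι) :
    stretch m t x i = (x i - min (coneParam (m a) x) (t / 2) * cellCenter (m a) i) /
      (1 - min (coneParam (m a) x) (t / 2)) := by
  rw [stretch, hm.stretchWeight_of_pos ht hx ha]
  congr 2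
  refine Finset.sum_eq_single a (fun b _ hb => ?_) (by simp)
  rw [hm.coneParam_eq_zero hx ha hb, min_eq_left (by linarith), zero_mul]

theorem IsFacetFamily.stretchWeight_le (hm : IsFacetFamily K m) {t : ℝ} (ht : 0 ≤ t)
    {x : ι → ℝ} (hx : x ∈ complexRealization K) : stretchWeight m t x ≤ t / 2 := by
  by_cases h : ∃ a, 0 < coneParam (m a) x
  · obtain ⟨a, ha⟩ := h
    rw [hm.stretchWeight_of_pos ht hx ha]
    exact min_le_right _ _
  · push Not at h
    have h0 : ∀ a, coneParam (m a) x = 0 := fun a => (h a).antisymm (coneParam_nonneg _ hx.1)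
    have : min 0 (t / 2) = 0 := min_eq_left (by linarith)
    simp only [stretchWeight, h0, this, Finset.sum_const_zero]
    linarith

theorem IsFacetFamily.stretch_mem (hm : IsFacetFamily K m) (hK : IsLowerSet K) {t : ℝ}
    (ht : 0 ≤ t) (ht1 : t ≤ 1) {x : ι → ℝ} (hx : x ∈ complexRealization K) :
    stretch m t x ∈ complexRealization K := by
  by_cases h : ∃ a, 0 < coneParam (m a) x
  · obtain ⟨a, ha⟩ := h
    have hs := hm.stretch_of_pos ht hx ha
    set μ := min (coneParam (m a) x) (t / 2) with hμ
    have hμ0 : 0 ≤ μ := le_min ha.le (by linarith)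
    have hμ1 : μ ≤ t / 2 := min_le_right _ _
    have hpos : 0 < 1 - μ := by linarith
    have hc : ∀ i, 0 ≤ cellCenter (m a) i := fun i => by
      unfold cellCenter; split_ifs <;> positivity
    refine complexRealization_mem_of_subset hK hx ⟨fun i => ?_, ?_⟩ fun i hi => ?_
    · rw [hs]
      refine div_nonneg (sub_nonneg.2 ?_) hpos.le
      exact (mul_le_mul_of_nonneg_right (min_le_left _ _) (hc i)).trans
        (coneParam_mul_cellCenter_le (m a) hx.1 i)
    · simp only [hs]
      rw [← Finset.sum_div, Finset.sum_sub_distrib, ← Finset.mul_sum, sum_cellCenter, hx.1.2,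
        mul_one, div_self hpos.ne']
    · have : i ∉ Finset.univ.map (m a) := by
        rw [← (hm.coneParam_pos_iff hx a).1 ha]
        exact notMem_vertexSupport.2 hi
      rw [hs, cellCenter_of_notMem _ this, hi]
      simp
  · push Not at h
    rw [stretch_of_eq_zero ht fun a => (h a).antisymm (coneParam_nonneg _ hx.1)]
    exact hx

/-- Once t/2 reaches the cone parameter, the whole weight of the barycentre is removed, so some
coordinate of the facet vanishes and the point is on its boundary. -/
theorem IsFacetFamily.stretch_mem_removeFacets (hm : IsFacetFamily K m) (hK : IsLowerSet K)
    {t : ℝ} (ht : 0 ≤ t) (ht1 : t ≤ 1) {x : ι → ℝ} (hx : x ∈ complexRealization K)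
    (hs : ∑ a, coneParam (m a) x ≤ t / 2) :
    stretch m t x ∈ complexRealization (removeFacets K m) := by
  refine ⟨(hm.stretch_mem hK ht ht1 hx).1, (hm.stretch_mem hK ht ht1 hx).2, fun b hb => ?_⟩
  rw [← hm.coneParam_pos_iff (hm.stretch_mem hK ht ht1 hx)] at hb
  by_cases h : ∃ a, 0 < coneParam (m a) x
  · obtain ⟨a, ha⟩ := h
    have hle : coneParam (m a) x ≤ t / 2 :=
      (Finset.single_le_sum (f := fun a => coneParam (m a) x)
        (fun a _ => coneParam_nonneg (m a) hx.1) (Finset.mem_univ a)).trans hs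
    have hst := hm.stretch_of_pos ht hx ha
    rw [min_eq_left hle] at hst
    have hba : b = a := by
      by_contra hne
      have hb' := (hm.coneParam_pos_iff (hm.stretch_mem hK ht ht1 hx) b).1 hb
      have h1 : Finset.univ.map (m b) ⊆ Finset.univ.map (m a) := by
        rw [← hb', ← (hm.coneParam_pos_iff hx a).1 ha]
        intro i hi
        rw [mem_vertexSupport] at hi ⊢
        intro h0
        have : i ∉ Finset.univ.map (m a) := by
          rw [← (hm.coneParam_pos_iff hx a).1 ha]
          exact notMem_vertexSupport.2 h0
        exact hi (by rw [hst, cellCenter_of_notMem _ this, h0]; simp)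
      exact hne (hm.injective (hm.maximal b _ (hm.mem a) h1)).symm
    subst hba
    obtain ⟨j, hj⟩ := exists_eq_minCoord (x ∘ m b)
    rw [_root_.coneParam_pos_iff _ (hm.stretch_mem hK ht ht1 hx).1] at hb
    have := mem_vertexSupport.1 (hb (Finset.mem_map_of_mem _ (Finset.mem_univ j)))
    refine this ?_
    have hn : (n : ℝ) + 1 ≠ 0 := by positivity
    have hj' : x (m b j) = minCoord (x ∘ m b) := hj
    rw [hst, cellCenter_apply, coneParam, hj']
    field_simp
    simp
  · push Not at h
    have h0 := fun a => (h a).antisymm (coneParam_nonneg (m a) hx.1)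
    rw [stretch_of_eq_zero ht h0, h0 b] at hb
    exact lt_irrefl _ hb

/-- A complex is homotopy equivalent to any quotient of it which collapses precisely the union of
the other faces to a point, provided that this union is contractible. -/
theorem IsFacetFamily.nonempty_homotopyEquiv (hm : IsFacetFamily K m) (hK : IsLowerSet K)
    (hA : ContractibleSpace (complexRealization (removeFacets K m)))
    {W : Type*} [TopologicalSpace W] {f : complexRealization K → W} (hf : IsQuotientMap f)
    (hfib : ∀ x y, f x = f y ↔ x = y ∨
      x.1 ∈ complexRealization (removeFacets K m) ∧ y.1 ∈ complexRealization (removeFacets K m)) :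
    Nonempty (ContinuousMap.HomotopyEquiv (complexRealization K) W) := by
  obtain ⟨p, ⟨H⟩⟩ := id_nullhomotopic (complexRealization (removeFacets K m))
  classical
  -- Off the subcomplex the value is a dummy; continuity is claimed and used on the subcomplex only.
  let G : I × (ι → ℝ) → (ι → ℝ) := fun q =>
    if hq : q.2 ∈ complexRealization (removeFacets K m) then (H (q.1, ⟨q.2, hq⟩)).1 else q.2
  have hG : ∀ t x (hx : x ∈ complexRealization (removeFacets K m)),
      G (t, x) = (H (t, ⟨x, hx⟩)).1 := fun t x hx => dif_pos hx
  have hGc : ContinuousOn G (Set.univ ×ˢ complexRealization (removeFacets K m)) := by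
    rw [continuousOn_iff_continuous_domRestrict]
    have : (Set.univ ×ˢ complexRealization (removeFacets K m)).domRestrict G =
        fun q => (H (q.1.1, ⟨q.1.2, q.2.2⟩)).1 := funext fun q => hG _ _ q.2.2
    rw [this]
    fun_prop
  -- The time at which a stretched point arrives in the subcomplex. In `h` it then follows the
  -- contraction, with the clock started on arrival.
  let totalParam : I × complexRealization K → ℝ := fun q => 2 * ∑ a, coneParam (m a) q.2.1
  have hcone := fun a => continuous_coneParam (m a)
  have hτ : Continuous totalParam := by fun_prop
  have hden : ∀ q : I × complexRealization K, 1 - stretchWeight m q.1.1 q.2.1 ≠ 0 := fun q => by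
    have h1 := hm.stretchWeight_le q.1.2.1 q.2.2
    have h2 := q.1.2.2
    have : 0 < 1 - stretchWeight m q.1.1 q.2.1 := by linarith
    exact this.ne'
  have hE : Continuous fun q : I × complexRealization K => stretch m q.1.1 q.2.1 := by
    refine continuous_pi fun i => ?_
    refine Continuous.div ?_ ?_ hden
    · have hc : ∀ a, Continuous fun q : I × complexRealization K => coneParam (m a) q.2.1 :=
        fun a => (hcone a).comp (by fun_prop)
      exact Continuous.sub ((continuous_apply i).comp (continuous_subtype_val.comp continuous_snd))
        (continuous_finsetSum _ fun a _ =>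
        ((hc a).min (by fun_prop)).mul continuous_const)
    · unfold stretchWeight
      fun_prop
  let h : I × complexRealization K → ι → ℝ := fun q =>
    if totalParam q ≤ q.1 then G (Set.projIcc 0 1 zero_le_one (q.1 - totalParam q), stretch m q.1 q.2)
    else stretch m q.1 q.2
  have hEA : ∀ q : I × complexRealization K, totalParam q ≤ q.1 →
      stretch m q.1 q.2 ∈ complexRealization (removeFacets K m) := fun q hq =>
    hm.stretch_mem_removeFacets hK q.1.2.1 q.1.2.2 q.2.2 (by
      have : 2 * ∑ a, coneParam (m a) q.2.1 ≤ q.1.1 := hq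
      linarith)
  have hhA : ∀ q : I × complexRealization K, totalParam q ≤ q.1 →
      h q ∈ complexRealization (removeFacets K m) := fun q hq => by
    simp only [h, if_pos hq]
    rw [hG _ _ (hEA q hq)]
    exact Subtype.coe_prop _
  have hhK : ∀ q, h q ∈ complexRealization K := fun q => by
    by_cases hq : totalParam q ≤ q.1
    · exact complexRealization_removeFacets_subset (hhA q hq)
    · simp only [h, if_neg hq]
      exact hm.stretch_mem hK q.1.2.1 q.1.2.2 q.2.2
  have hhc : Continuous h := by
    -- On arrival the clock reads 0, where the contraction is the identity, so the two formulas
    -- agree.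
    refine continuous_if_le hτ (by fun_prop) ?_ hE.continuousOn ?_
    · refine hGc.comp (Continuous.continuousOn ?_) fun q hq => ⟨Set.mem_univ _, hEA q hq⟩
      refine Continuous.prodMk (continuous_projIcc.comp ?_) hE
      fun_prop
    · intro q hq
      rw [hq, sub_self, Set.projIcc_left]
      rw [hG _ _ (hEA q hq.le)]
      simp
  have hτA : ∀ t (x : complexRealization K), x.1 ∈ complexRealization (removeFacets K m) →
      totalParam (t, x) = 0 := fun t x hx => by
    simp [totalParam, (mem_removeFacets_iff hm x.2).1 hx]
  refine hf.nonempty_homotopyEquiv (h := fun q => ⟨h q, hhK q⟩) (hhc.subtype_mk _) ?_ ?_ ?_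
  · intro x
    apply Subtype.ext
    change h (0, x) = x.1
    have hmin : ∀ a, min (coneParam (m a) x.1) (((0 : I) : ℝ) / 2) = 0 := fun a => by
      simpa using coneParam_nonneg (m a) x.2.1
    have hE0 : stretch m ((0 : I) : ℝ) x.1 = x.1 := by
      funext i
      simp only [stretch, stretchWeight, hmin]
      simp
    by_cases hq : totalParam (0, x) ≤ (0 : I)
    · have hx := hEA _ hq
      simp only at hx
      simp only [h, if_pos hq]
      rw [hG _ _ hx]
      have h0 : (Set.projIcc 0 1 zero_le_one (((0 : I) : ℝ) - totalParam (0, x)) : I) = 0 := by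
        refine Set.projIcc_of_le_left _ ?_
        have : 0 ≤ totalParam (0, x) := mul_nonneg zero_le_two
          (Finset.sum_nonneg fun a _ => coneParam_nonneg (m a) x.2.1)
        simpa using this
      rw [h0, H.apply_zero]
      exact hE0
    · simp only [h, if_neg hq]
      exact hE0
  -- The only nontrivial fibre is the subcomplex. Its points arrive at time 0 and stay inside; at
  -- time 1 they have all reached `p`.
  · intro t x y hxy
    rcases (hfib x y).1 hxy with rfl | ⟨hx, hy⟩
    · rfl
    · refine (hfib _ _).2 (Or.inr ⟨hhA (t, x) ?_, hhA (t, y) ?_⟩)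
      · rw [hτA t x hx]
        exact t.2.1
      · rw [hτA t y hy]
        exact t.2.1
  · intro x y hxy
    have key : ∀ x : complexRealization K, x.1 ∈ complexRealization (removeFacets K m) →
        h (1, x) = p.1 := fun x hx => by
      have hq : totalParam (1, x) ≤ (1 : I) := by
        rw [hτA 1 x hx]
        exact zero_le_one
      simp only [h, if_pos hq]
      rw [hG _ _ (hEA (1, x) hq), hτA 1 x hx]
      have : (Set.projIcc 0 1 zero_le_one (((1 : I) : ℝ) - 0) : I) = 1 :=
        Set.projIcc_of_right_le _ (by simp)
      rw [this, H.apply_one]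
      rfl
    rcases (hfib x y).1 hxy with rfl | ⟨hx, hy⟩
    · rfl
    · exact Subtype.ext ((key x hx).trans (key y hy).symm)

end Stretch

/-! ### The quotient by the other faces as a wedge of spheres. -/

section CellQuotient

open Topology unitInterval

variable {ι κ : Type*} {n : ℕ}

theorem extend_comp_self (e : Fin (n + 1) ↪ ι) (y : Fin (n + 1) → ℝ) :
    Function.extend e y 0 ∘ e = y :=
  funext fun j => e.injective.extend_apply _ _ j

variable [Fintype ι] {K : Set (Finset ι)} {m : κ → Fin (n + 1) ↪ ι}

theorem extend_mem_stdSimplex (e : Fin (n + 1) ↪ ι) {y : Fin (n + 1) → ℝ}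
    (hy : y ∈ stdSimplex ℝ (Fin (n + 1))) : Function.extend e y 0 ∈ stdSimplex ℝ ι := by
  classical
  refine ⟨fun i => ?_, ?_⟩
  · by_cases hi : ∃ j, e j = i
    · obtain ⟨j, rfl⟩ := hi
      rw [e.injective.extend_apply]
      exact hy.1 j
    · rw [Function.extend_apply' _ _ _ hi]
      rfl
  · rw [← hy.2, ← Finset.sum_subset (Finset.subset_univ (Finset.univ.map e)), Finset.sum_map]
    · simp only [e.injective.extend_apply]
    · intro i _ hi
      rw [Function.extend_apply' _ _ _ (by simpa using hi)]
      rfl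

theorem vertexSupport_extend_subset (e : Fin (n + 1) ↪ ι) (y : Fin (n + 1) → ℝ) :
    vertexSupport (Function.extend e y 0) ⊆ Finset.univ.map e := by
  intro i hi
  by_contra h
  refine mem_vertexSupport.1 hi ?_
  rw [Function.extend_apply' _ _ _ (by simpa using h)]
  rfl

theorem extend_comp_of_vertexSupport_subset (e : Fin (n + 1) ↪ ι) {x : ι → ℝ}
    (hx : vertexSupport x ⊆ Finset.univ.map e) : Function.extend e (x ∘ e) 0 = x := by
  funext i
  by_cases hi : ∃ j, e j = i
  · obtain ⟨j, rfl⟩ := hi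
    rw [e.injective.extend_apply]
    rfl
  · rw [Function.extend_apply' _ _ _ hi]
    have : i ∉ Finset.univ.map e := by simpa using hi
    exact (notMem_vertexSupport.1 fun h => this (hx h)).symm

theorem comp_mem_stdSimplex (e : Fin (n + 1) ↪ ι) {x : ι → ℝ} (hx : x ∈ stdSimplex ℝ ι)
    (h : vertexSupport x ⊆ Finset.univ.map e) : x ∘ e ∈ stdSimplex ℝ (Fin (n + 1)) := by
  refine ⟨fun j => hx.1 _, ?_⟩
  rw [← hx.2, ← Finset.sum_subset (Finset.subset_univ (Finset.univ.map e)), Finset.sum_map]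
  · rfl
  · intro i _ hi
    exact notMem_vertexSupport.1 fun h' => hi (h h')

/-- The closed cell of a face. -/
noncomputable def IsFacetFamily.cell (hm : IsFacetFamily K m) (hK : IsLowerSet K) (a : κ)
    (y : stdSimplex ℝ (Fin (n + 1))) : complexRealization K :=
  ⟨Function.extend (m a) y.1 0, extend_mem_stdSimplex _ y.2,
    hK (vertexSupport_extend_subset _ _) (hm.mem a)⟩

theorem IsFacetFamily.continuous_cell (hm : IsFacetFamily K m) (hK : IsLowerSet K) (a : κ) :
    Continuous (hm.cell hK a) := by
  refine Continuous.subtype_mk (continuous_pi fun i => ?_) _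
  by_cases hi : ∃ j, m a j = i
  · obtain ⟨j, rfl⟩ := hi
    simp only [(m a).injective.extend_apply]
    exact (continuous_apply j).comp continuous_subtype_val
  · simp only [Function.extend_apply' _ _ _ hi]
    exact continuous_const

theorem IsFacetFamily.coneParam_cell (hm : IsFacetFamily K m) (hK : IsLowerSet K) (a : κ)
    (y : stdSimplex ℝ (Fin (n + 1))) :
    coneParam (m a) (hm.cell hK a y).1 = (n + 1) * minCoord y.1 := by
  rw [coneParam]
  congr 2
  exact extend_comp_self _ _

theorem IsFacetFamily.coneParam_cell_of_ne (hm : IsFacetFamily K m) (hK : IsLowerSet K) {a b : κ}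
    (hab : b ≠ a) (y : stdSimplex ℝ (Fin (n + 1))) :
    coneParam (m b) (hm.cell hK a y).1 = 0 := by
  by_contra h
  have hb := (coneParam_nonneg (m b) (hm.cell hK a y).2.1).lt_of_ne' h
  rw [hm.coneParam_pos_iff (hm.cell hK a y).2] at hb
  have h1 : Finset.univ.map (m b) ⊆ Finset.univ.map (m a) :=
    hb ▸ vertexSupport_extend_subset (m a) y.1
  exact hab (hm.injective (hm.maximal b _ (hm.mem a) h1)).symm

theorem IsFacetFamily.cell_mem_removeFacets_iff (hm : IsFacetFamily K m) (hK : IsLowerSet K)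
    (a : κ) (y : stdSimplex ℝ (Fin (n + 1))) :
    (hm.cell hK a y).1 ∈ complexRealization (removeFacets K m) ↔ minCoord y.1 = 0 := by
  have hn : (n : ℝ) + 1 ≠ 0 := by positivity
  rw [mem_removeFacets_iff hm (hm.cell hK a y).2]
  constructor
  · intro h
    have := h a
    rw [hm.coneParam_cell hK] at this
    exact (mul_eq_zero.1 this).resolve_left hn
  · intro h b
    by_cases hb : b = a
    · subst hb
      rw [hm.coneParam_cell hK, h, mul_zero]
    · exact hm.coneParam_cell_of_ne hK hb y

theorem IsFacetFamily.exists_cell_eq (hm : IsFacetFamily K m) (hK : IsLowerSet K)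
    (x : complexRealization K) (hx : x.1 ∉ complexRealization (removeFacets K m)) :
    ∃ a y, minCoord y.1 ≠ 0 ∧ hm.cell hK a y = x := by
  obtain ⟨a, ha⟩ : ∃ a, vertexSupport x.1 = Finset.univ.map (m a) := by
    by_contra h
    push Not at h
    exact hx ⟨x.2.1, x.2.2, h⟩
  have hxa : hm.cell hK a ⟨x.1 ∘ m a, comp_mem_stdSimplex _ x.2.1 ha.le⟩ = x :=
    Subtype.ext (extend_comp_of_vertexSupport_subset _ ha.le)
  refine ⟨a, ⟨x.1 ∘ m a, comp_mem_stdSimplex _ x.2.1 ha.le⟩, fun h => hx ?_, hxa⟩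
  rw [← hxa]
  exact (hm.cell_mem_removeFacets_iff hK a _).2 h

theorem IsFacetFamily.cell_injective (hm : IsFacetFamily K m) (hK : IsLowerSet K) {a b : κ}
    {y z : stdSimplex ℝ (Fin (n + 1))} (hy : minCoord y.1 ≠ 0)
    (h : hm.cell hK a y = hm.cell hK b z) : a = b ∧ y = z := by
  have hab : a = b := by
    by_contra hne
    have h1 := hm.coneParam_cell hK a y
    rw [h, hm.coneParam_cell_of_ne hK hne] at h1
    have hn : (n : ℝ) + 1 ≠ 0 := by positivity
    exact hy ((mul_eq_zero.1 h1.symm).resolve_left hn)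
  subst hab
  refine ⟨rfl, Subtype.ext ?_⟩
  rw [← extend_comp_self (m a) y.1, ← extend_comp_self (m a) z.1]
  exact congrArg (fun x : complexRealization K => x.1 ∘ m a) h

variable {k : ℕ} [NeZero k] {m : Fin k → Fin (n + 1) ↪ ι}

open Classical in
/-- The map from a complex to a wedge of spheres which collapses the faces outside a family of
facets to the base point. -/
noncomputable def IsFacetFamily.toWedge (hm : IsFacetFamily K m) (hK : IsLowerSet K)
    (x : complexRealization K) : WedgeOfSpheres k n :=
  if hx : x.1 ∈ complexRealization (removeFacets K m) then Wedge.mk (fun _ => sphereBase n) ⟨0, sphereBase n⟩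
  else Wedge.mk (fun _ => sphereBase n) ⟨(hm.exists_cell_eq hK x hx).choose,
    simplexToSphere n (hm.exists_cell_eq hK x hx).choose_spec.choose⟩

theorem IsFacetFamily.toWedge_of_mem (hm : IsFacetFamily K m) (hK : IsLowerSet K)
    {x : complexRealization K} (hx : x.1 ∈ complexRealization (removeFacets K m)) :
    hm.toWedge hK x = Wedge.mk (fun _ => sphereBase n) ⟨0, sphereBase n⟩ :=
  dif_pos hx

/-- The formula holds on the closed cell, since the boundary goes to the base point on both sides.
This removes the choices made in `toWedge`. -/
theorem IsFacetFamily.toWedge_cell (hm : IsFacetFamily K m) (hK : IsLowerSet K) (a : Fin k)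
    (y : stdSimplex ℝ (Fin (n + 1))) :
    hm.toWedge hK (hm.cell hK a y) = Wedge.mk (fun _ => sphereBase n) ⟨a, simplexToSphere n y⟩ := by
  by_cases hy : minCoord y.1 = 0
  · rw [hm.toWedge_of_mem hK ((hm.cell_mem_removeFacets_iff hK a y).2 hy),
      (simplexToSphere_eq_base_iff y).2 hy]
    exact (Wedge.mk_eq_mk_iff _ _).2 (Or.inr ⟨rfl, rfl⟩)
  · have hx := (hm.cell_mem_removeFacets_iff hK a y).not.2 hy
    have hspec := (hm.exists_cell_eq hK _ hx).choose_spec.choose_spec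
    have := hm.cell_injective hK hspec.1 hspec.2
    rw [IsFacetFamily.toWedge, dif_neg hx]
    congr 1
    exact Sigma.ext this.1 (heq_of_eq (congrArg (simplexToSphere n) this.2))

/-- By compactness the complex is a quotient of the disjoint union of the subcomplex and the closed
cells, and on each of these pieces continuity is clear. -/
theorem IsFacetFamily.continuous_toWedge (hm : IsFacetFamily K m) (hK : IsLowerSet K) :
    Continuous (hm.toWedge hK) := by
  have hcK := isCompact_iff_compactSpace.1 (isCompact_complexRealization hK)
  have hcA := isCompact_iff_compactSpace.1
    (isCompact_complexRealization (hm.isLowerSet_removeFacets hK))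
  let Q : complexRealization (removeFacets K m) ⊕ (Σ _ : Fin k, stdSimplex ℝ (Fin (n + 1))) →
      complexRealization K :=
    Sum.elim (Set.inclusion complexRealization_removeFacets_subset) fun p => hm.cell hK p.1 p.2
  have hQc : Continuous Q :=
    (continuous_inclusion _).sumElim (continuous_sigma fun a => hm.continuous_cell hK a)
  have hQs : Function.Surjective Q := by
    intro x
    by_cases hx : x.1 ∈ complexRealization (removeFacets K m)
    · exact ⟨Sum.inl ⟨x.1, hx⟩, rfl⟩
    · obtain ⟨a, y, -, h⟩ := hm.exists_cell_eq hK x hx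
      exact ⟨Sum.inr ⟨a, y⟩, h⟩
  have hQ : IsQuotientMap Q := hQc.isClosedMap.isQuotientMap hQc hQs
  rw [hQ.continuous_iff, continuous_sum_dom]
  constructor
  · have : (hm.toWedge hK ∘ Q) ∘ Sum.inl = fun _ => Wedge.mk (fun _ => sphereBase n) ⟨0, sphereBase n⟩ :=
      funext fun x => hm.toWedge_of_mem hK x.2
    rw [this]
    exact continuous_const
  · refine continuous_sigma fun a => ?_
    have : (fun y => ((hm.toWedge hK ∘ Q) ∘ Sum.inr) ⟨a, y⟩) =
        fun y => Wedge.mk (fun _ => sphereBase n) ⟨a, simplexToSphere n y⟩ :=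
      funext fun y => hm.toWedge_cell hK a y
    rw [this]
    exact (Wedge.isQuotientMap_mk _).continuous.comp (continuous_sigmaMk.comp (simplexToSphere n).continuous)

/-- Composed with the cells, the map factors as a closed surjection of simplices onto spheres
followed by the wedge projection. A map is a quotient map if such a composite is. -/
theorem IsFacetFamily.isQuotientMap_toWedge (hm : IsFacetFamily K m) (hK : IsLowerSet K)
    (hn : n ≠ 0) : IsQuotientMap (hm.toWedge hK) := by
  let c : (Σ _ : Fin k, stdSimplex ℝ (Fin (n + 1))) → complexRealization K :=
    fun p => hm.cell hK p.1 p.2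
  let s : (Σ _ : Fin k, stdSimplex ℝ (Fin (n + 1))) → Σ _ : Fin k, unitSphere n :=
    fun p => ⟨p.1, simplexToSphere n p.2⟩
  have hc : Continuous c := continuous_sigma fun a => hm.continuous_cell hK a
  have hs : Continuous s :=
    continuous_sigma fun a => continuous_sigmaMk.comp (simplexToSphere n).continuous
  have hsurj : Function.Surjective s := by
    rintro ⟨a, p⟩
    obtain ⟨y, rfl⟩ := simplexToSphere_surjective hn p
    exact ⟨⟨a, y⟩, rfl⟩
  have hcomp : hm.toWedge hK ∘ c = Wedge.mk (fun _ => sphereBase n) ∘ s := funext fun p => hm.toWedge_cell hK p.1 p.2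
  refine IsQuotientMap.of_comp hc (hm.continuous_toWedge hK) ?_
  rw [hcomp]
  exact (Wedge.isQuotientMap_mk _).comp (hs.isClosedMap.isQuotientMap hs hsurj)

theorem IsFacetFamily.toWedge_eq_iff (hm : IsFacetFamily K m) (hK : IsLowerSet K)
    (x y : complexRealization K) :
    hm.toWedge hK x = hm.toWedge hK y ↔ x = y ∨
      x.1 ∈ complexRealization (removeFacets K m) ∧
        y.1 ∈ complexRealization (removeFacets K m) := by
  have key : ∀ x y : complexRealization K, x.1 ∉ complexRealization (removeFacets K m) →
      hm.toWedge hK x = hm.toWedge hK y → x = y := by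
    intro x y hx h
    obtain ⟨a, u, hu, rfl⟩ := hm.exists_cell_eq hK x hx
    have hub : simplexToSphere n u ≠ sphereBase n := (simplexToSphere_eq_base_iff u).not.2 hu
    rw [hm.toWedge_cell] at h
    by_cases hy : y.1 ∈ complexRealization (removeFacets K m)
    · rw [hm.toWedge_of_mem hK hy, Wedge.mk_eq_mk_iff] at h
      rcases h with h | h
      · rw [Sigma.mk.injEq] at h
        exact absurd (eq_of_heq h.2) hub
      · exact absurd h.1 hub
    · obtain ⟨b, v, hv, rfl⟩ := hm.exists_cell_eq hK y hy
      rw [hm.toWedge_cell, Wedge.mk_eq_mk_iff] at h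
      rcases h with h | h
      · rw [Sigma.mk.injEq] at h
        obtain ⟨rfl, h⟩ := h
        rw [simplexToSphere_injOn (eq_of_heq h) hu]
      · exact absurd h.1 hub
  constructor
  · intro h
    by_cases hx : x.1 ∈ complexRealization (removeFacets K m)
    · by_cases hy : y.1 ∈ complexRealization (removeFacets K m)
      · exact Or.inr ⟨hx, hy⟩
      · exact Or.inl (key y x hy h.symm).symm
    · exact Or.inl (key x y hx h)
  · rintro (rfl | ⟨hx, hy⟩)
    · rfl
    · rw [hm.toWedge_of_mem hK hx, hm.toWedge_of_mem hK hy]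

/-- If the complement of `k` facets of dimension `n ≥ 1` in a simplicial complex is contractible,
then the complex is homotopy equivalent to the wedge of `k` spheres of dimension `n`. -/
theorem IsFacetFamily.nonempty_homotopyEquiv_wedgeOfSpheres (hm : IsFacetFamily K m)
    (hK : IsLowerSet K) (hn : n ≠ 0)
    (hA : ContractibleSpace (complexRealization (removeFacets K m))) :
    Nonempty (ContinuousMap.HomotopyEquiv (complexRealization K) (WedgeOfSpheres k n)) :=
  hm.nonempty_homotopyEquiv hK hA (hm.isQuotientMap_toWedge hK hn) (hm.toWedge_eq_iff hK)

end CellQuotient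

/-! ### Cones and elementary collapses. -/

section Collapse

open Topology unitInterval

variable {ι : Type*} [Fintype ι] {K : Set (Finset ι)}

/-- A nonempty simplicial complex is contractible if every face can be extended by a given
vertex. -/
theorem contractibleSpace_complexRealization_of_cone [DecidableEq ι] (hK : IsLowerSet K) {v : ι}
    (hv : ∀ F ∈ K, insert v F ∈ K) (hne : K.Nonempty) :
    ContractibleSpace (complexRealization K) := by
  have hapex : Pi.single v 1 ∈ complexRealization K := by
    refine ⟨single_mem_stdSimplex ℝ v, ?_⟩
    obtain ⟨F, hF⟩ := hne
    refine hK (fun i hi => ?_) (hv F hF)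
    rw [mem_vertexSupport] at hi
    by_contra h
    exact hi (Pi.single_eq_of_ne (fun h' => h (by rw [h']; exact Finset.mem_insert_self _ _)) _)
  have hmem : ∀ q : I × complexRealization K,
      (1 - (q.1 : ℝ)) • q.2.1 + (q.1 : ℝ) • (Pi.single v 1 : ι → ℝ) ∈ complexRealization K := by
    intro q
    refine ⟨convex_stdSimplex ℝ ι q.2.2.1 hapex.1 (sub_nonneg.2 q.1.2.2) q.1.2.1 (by ring), ?_⟩
    refine hK (fun i hi => ?_) (hv _ q.2.2.2)
    rw [mem_vertexSupport] at hi
    by_contra h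
    rw [Finset.mem_insert, not_or, notMem_vertexSupport] at h
    refine hi ?_
    simp [h.2, Pi.single_eq_of_ne h.1]
  rw [contractible_iff_id_nullhomotopic]
  refine ⟨⟨_, hapex⟩, ⟨{
    toFun := fun q => ⟨_, hmem q⟩
    continuous_toFun := ?_
    map_zero_left := fun x => ?_
    map_one_left := fun x => ?_ }⟩⟩
  · exact Continuous.subtype_mk (by fun_prop) _
  · apply Subtype.ext
    simp
  · apply Subtype.ext
    simp

/-- An elementary collapse: if a face `T` is properly contained in exactly one other face, which
has one more vertex `v`, then removing the two faces does not affect contractibility. -/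
theorem contractibleSpace_complexRealization_of_collapse [DecidableEq ι] {n : ℕ}
    (hK : IsLowerSet K) (T : Fin (n + 1) ↪ ι) {v : ι} (hv : v ∉ Finset.univ.map T)
    (hvK : insert v (Finset.univ.map T) ∈ K)
    (hT : ∀ F ∈ K, Finset.univ.map T ⊆ F → F ⊆ insert v (Finset.univ.map T))
    (hA : ContractibleSpace (complexRealization {F | F ∈ K ∧ ¬ Finset.univ.map T ⊆ F})) :
    ContractibleSpace (complexRealization K) := by
  set A := {F | F ∈ K ∧ ¬ Finset.univ.map T ⊆ F} with hAdef
  have hsub : complexRealization A ⊆ complexRealization K := fun x hx => ⟨hx.1, hx.2.1⟩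
  -- Every vertex of `T` gives t times the least coordinate on `T` to `v`. As `T` has n + 1
  -- vertices, the total is preserved; at t = 1 a coordinate on `T` vanishes.
  let push : ℝ → (ι → ℝ) → ι → ℝ := fun t x i =>
    x i + t * minCoord (x ∘ T) *
      (if i = v then (n : ℝ) + 1 else if i ∈ Finset.univ.map T then -1 else 0)
  have hmin := continuous_minCoord (n := n)
  have hpc : Continuous fun q : ℝ × (ι → ℝ) => push q.1 q.2 := by fun_prop
  have hsum : ∑ i, (if i = v then (n : ℝ) + 1 else if i ∈ Finset.univ.map T then -1 else 0) = 0 := by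
    have h1 : ∀ i, (if i = v then (n : ℝ) + 1 else if i ∈ Finset.univ.map T then (-1 : ℝ) else 0) =
        (if i = v then (n : ℝ) + 1 else 0) + if i ∈ Finset.univ.map T then (-1 : ℝ) else 0 := by
      intro i
      by_cases hi : i = v
      · subst hi
        simp only [if_true, if_neg hv, add_zero]
      · simp only [if_neg hi, zero_add]
    simp only [h1, Finset.sum_add_distrib]
    rw [Finset.sum_ite_eq', if_pos (Finset.mem_univ _), Finset.sum_ite_mem, Finset.univ_inter]
    simp
  have hpos : ∀ x ∈ complexRealization K, 0 < minCoord (x ∘ T) ↔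
      Finset.univ.map T ⊆ vertexSupport x := by
    intro x hx
    rw [← coneParam_pos_iff T hx.1, coneParam, mul_pos_iff_of_pos_left (by positivity)]
  have hstd : ∀ t : I, ∀ x ∈ complexRealization K, push t x ∈ stdSimplex ℝ ι := by
    intro t x hx
    have h0 : 0 ≤ minCoord (x ∘ T) := minCoord_nonneg fun j => hx.1.1 _
    refine ⟨fun i => ?_, ?_⟩
    · have hx0 := hx.1.1 i
      have ht0 := t.2.1
      have ht1 := t.2.2
      simp only [push]
      split_ifs with h1 h2
      · positivity
      · obtain ⟨j, -, rfl⟩ := Finset.mem_map.1 h2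
        have := minCoord_le (x ∘ T) j
        simp only [Function.comp_apply] at this
        nlinarith
      · simpa using hx0
    · simp only [push, Finset.sum_add_distrib, ← Finset.mul_sum, hsum, mul_zero, add_zero]
      exact hx.1.2
  have hsupp : ∀ t : I, ∀ x ∈ complexRealization K, 0 < minCoord (x ∘ T) →
      vertexSupport (push t x) ⊆ insert v (Finset.univ.map T) := by
    intro t x hx h i hi
    by_contra hi'
    have hxi : x i = 0 := notMem_vertexSupport.1 fun h' => hi' (hT _ hx.2 ((hpos x hx).1 h) h')
    rw [Finset.mem_insert, not_or] at hi'
    refine mem_vertexSupport.1 hi ?_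
    simp only [push, if_neg hi'.1, if_neg hi'.2, hxi, mul_zero, add_zero]
  have hfix : ∀ t : ℝ, ∀ x : ι → ℝ, minCoord (x ∘ T) = 0 → push t x = x := by
    intro t x h
    funext i
    simp only [push, h, mul_zero, zero_mul, add_zero]
  have hmemK : ∀ t : I, ∀ x ∈ complexRealization K, push t x ∈ complexRealization K := by
    intro t x hx
    rcases (minCoord_nonneg fun j => hx.1.1 (T j) : 0 ≤ minCoord (x ∘ T)).eq_or_lt with h | h
    · rw [hfix _ _ h.symm]
      exact hx
    · exact ⟨hstd t x hx, hK (hsupp t x hx h) hvK⟩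
  have hmemA : ∀ x ∈ complexRealization K, push 1 x ∈ complexRealization A := by
    intro x hx
    have h1 := hmemK 1 x hx
    rw [Set.Icc.coe_one] at h1
    refine ⟨h1.1, h1.2, fun h => ?_⟩
    obtain ⟨j, hj⟩ := exists_eq_minCoord (x ∘ T)
    refine mem_vertexSupport.1 (h (Finset.mem_map_of_mem T (Finset.mem_univ j))) ?_
    have hjT := Finset.mem_map_of_mem T (Finset.mem_univ j)
    have hjv : T j ≠ v := fun h' => hv (h' ▸ hjT)
    simp only [push, if_neg hjv, if_pos hjT, ← hj, Function.comp_apply]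
    ring
  have hfixA : ∀ t : ℝ, ∀ x ∈ complexRealization A, push t x = x := by
    intro t x hx
    refine hfix t x (le_antisymm (le_of_not_gt fun h => ?_) (minCoord_nonneg fun j => hx.1.1 _))
    exact hx.2.2 ((hpos x (hsub hx)).1 h)
  let e : ContinuousMap.HomotopyEquiv (complexRealization K) (complexRealization A) := {
    toFun := ⟨fun x => ⟨push 1 x, hmemA x x.2⟩,
      Continuous.subtype_mk (hpc.comp (by fun_prop : Continuous fun x : complexRealization K =>
        ((1 : ℝ), x.1))) _⟩
    invFun := ⟨Set.inclusion hsub, continuous_inclusion hsub⟩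
    left_inv := ⟨ContinuousMap.Homotopy.symm
      { toFun := fun q => ⟨push q.1 q.2, hmemK q.1 q.2 q.2.2⟩
        continuous_toFun := Continuous.subtype_mk (hpc.comp
          (by fun_prop : Continuous fun q : I × complexRealization K => ((q.1 : ℝ), q.2.1))) _
        map_zero_left := fun x => Subtype.ext (by
          funext i
          simp [push])
        map_one_left := fun x => Subtype.ext (by rfl) }⟩
    right_inv := by
      have : ∀ x, (⟨push 1 (Set.inclusion hsub x).1, hmemA _ (Set.inclusion hsub x).2⟩ :
          complexRealization A) = x := fun x => Subtype.ext (hfixA 1 x x.2)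
      refine ⟨?_⟩
      convert ContinuousMap.Homotopy.refl (ContinuousMap.id (complexRealization A)) using 1
      exact ContinuousMap.ext this }
  exact e.contractibleSpace

end Collapse

/-! ### Barycentric subdivision. -/

section Subdivision

variable {ι P : Type*} [DecidableEq ι] [Fintype P] {e : P → Finset ι}

/-- The combination of the indicator functions of a finite family of finite sets with given
coefficients. -/
def indicatorSum (e : P → Finset ι) (c : P → ℝ) (i : ι) : ℝ :=
  ∑ p, if i ∈ e p then c p else 0

theorem le_indicatorSum {c : P → ℝ} (hc : ∀ p, 0 ≤ c p) {p : P} {i : ι} (hi : i ∈ e p) :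
    c p ≤ indicatorSum e c i := by
  have := Finset.single_le_sum (f := fun p => if i ∈ e p then c p else 0)
    (fun q _ => by split_ifs; exacts [hc q, le_rfl]) (Finset.mem_univ p)
  rwa [if_pos hi] at this

theorem indicatorSum_nonneg {c : P → ℝ} (hc : ∀ p, 0 ≤ c p) (i : ι) : 0 ≤ indicatorSum e c i :=
  Finset.sum_nonneg fun q _ => by split_ifs; exacts [hc q, le_rfl]

theorem exists_of_indicatorSum_ne_zero {c : P → ℝ} {i : ι} (h : indicatorSum e c i ≠ 0) :
    ∃ p, i ∈ e p ∧ c p ≠ 0 := by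
  obtain ⟨p, -, hp⟩ := Finset.exists_ne_zero_of_sum_ne_zero h
  by_cases hi : i ∈ e p
  · exact ⟨p, hi, by simpa [hi] using hp⟩
  · simp [hi] at hp

theorem indicatorSum_update [DecidableEq P] (c : P → ℝ) (p : P) (r : ℝ) (i : ι) :
    indicatorSum e (Function.update c p r) i =
      indicatorSum e c i + if i ∈ e p then r - c p else 0 := by
  have h : ∀ q, (if i ∈ e q then Function.update c p r q else 0) =
      (if i ∈ e q then c q else 0) + if q = p then (if i ∈ e p then r - c p else 0) else 0 := by
    intro q
    by_cases hq : q = p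
    · subst hq
      by_cases hi : i ∈ e q <;> simp [hi]
    · simp [hq]
  simp only [indicatorSum, h, Finset.sum_add_distrib, Finset.sum_ite_eq', Finset.mem_univ, if_true]

theorem sum_indicatorSum [Fintype ι] (c : P → ℝ) :
    ∑ i, indicatorSum e c i = ∑ p, c p * (e p).card := by
  simp only [indicatorSum]
  rw [Finset.sum_comm]
  refine Finset.sum_congr rfl fun p _ => ?_
  rw [Finset.sum_ite_mem, Finset.univ_inter, Finset.sum_const, nsmul_eq_mul, mul_comm]

variable [PartialOrder P]

/-- A nonempty finite chain has a least element. -/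
theorem exists_least_of_isChain {c : P → ℝ} (hc : IsChain (· ≤ ·) (Function.support c)) {p : P}
    (hp : c p ≠ 0) : ∃ p₀, c p₀ ≠ 0 ∧ ∀ q, c q ≠ 0 → p₀ ≤ q := by
  obtain ⟨p₀, hp₀⟩ := (Set.toFinite (Function.support c)).exists_minimal ⟨p, hp⟩
  refine ⟨p₀, hp₀.1, fun q hq => ?_⟩
  rcases hc.total hp₀.1 hq with h | h
  · exact h
  · exact hp₀.2 hq h

variable (he : ∀ p q, p ≤ q ↔ e q ⊆ e p) (hne : ∀ p, (e p).Nonempty)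

include he in
-- Since `e` reverses the order, the least member of the chain carries the largest set, which
-- contains all the others.
theorem indicatorSum_ne_zero_iff {c : P → ℝ} (hc : ∀ p, 0 ≤ c p) {p₀ : P} (h0 : c p₀ ≠ 0)
    (hp₀ : ∀ q, c q ≠ 0 → p₀ ≤ q) (i : ι) : indicatorSum e c i ≠ 0 ↔ i ∈ e p₀ := by
  constructor
  · intro h
    obtain ⟨p, hi, hp⟩ := exists_of_indicatorSum_ne_zero h
    exact (he _ _).1 (hp₀ p hp) hi
  · intro hi
    exact (((hc p₀).lt_of_ne' h0).trans_le (le_indicatorSum hc hi)).ne'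

include he hne in
theorem exists_indicatorSum_eq {c : P → ℝ} (hch : IsChain (· ≤ ·) (Function.support c)) {p₀ : P}
    (hp₀ : ∀ q, c q ≠ 0 → p₀ ≤ q) : ∃ i ∈ e p₀, indicatorSum e c i = c p₀ := by
  classical
  -- A point of the largest set outside the second largest, or any point if there is no second one.
  -- Only the coefficient of `p₀` contributes there.
  have key : ∃ i ∈ e p₀, ∀ q, q ≠ p₀ → c q ≠ 0 → i ∉ e q := by
    by_cases h : ∃ q, q ≠ p₀ ∧ c q ≠ 0
    · obtain ⟨q, hq, hcq⟩ := h
      have hch' : IsChain (· ≤ ·) (Function.support (Function.update c p₀ 0)) :=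
        hch.mono fun r hr => by
          by_cases hr0 : r = p₀
          · subst hr0
            simp at hr
          · simpa [hr0] using hr
      obtain ⟨p₁, h1, hp₁⟩ := exists_least_of_isChain hch' (p := q) (by simpa [hq] using hcq)
      have h10 : p₁ ≠ p₀ := by
        rintro rfl
        simp at h1
      have hc1 : c p₁ ≠ 0 := by simpa [h10] using h1
      have hns : ¬ e p₀ ⊆ e p₁ := fun hs => h10 (le_antisymm ((he _ _).2 hs) (hp₀ _ hc1))
      obtain ⟨i, hi, hi1⟩ := Finset.not_subset.1 hns
      refine ⟨i, hi, fun q hq hcq hiq => hi1 ?_⟩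
      exact (he _ _).1 (hp₁ q (by simpa [hq] using hcq)) hiq
    · push Not at h
      obtain ⟨i, hi⟩ := hne p₀
      exact ⟨i, hi, fun q hq hcq => absurd (h q hq) hcq⟩
  obtain ⟨i, hi, h⟩ := key
  refine ⟨i, hi, ?_⟩
  rw [indicatorSum, Finset.sum_eq_single p₀]
  · rw [if_pos hi]
  · intro q _ hq
    by_cases hcq : c q = 0
    · simp [hcq]
    · rw [if_neg (h q hq hcq)]
  · simp

include he hne in
/-- Nonnegative combinations of the indicator functions of a chain of nonempty sets determine their
coefficients. -/
theorem indicatorSum_injective {c d : P → ℝ} (hc : ∀ p, 0 ≤ c p) (hd : ∀ p, 0 ≤ d p)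
    (hcc : IsChain (· ≤ ·) (Function.support c)) (hdc : IsChain (· ≤ ·) (Function.support d))
    (h : indicatorSum e c = indicatorSum e d) : c = d := by
  classical
  -- The sum determines its largest set, as its support, and the coefficient of that set, as its
  -- minimum there. Both are split off.
  induction hN : (Function.support c).ncard using Nat.strong_induction_on generalizing c d with
  | _ N ih =>
  by_cases h0 : ∃ p, c p ≠ 0
  · obtain ⟨p, hp⟩ := h0
    obtain ⟨p₀, hcp, hp₀⟩ := exists_least_of_isChain hcc hp
    have hsc := indicatorSum_ne_zero_iff he hc hcp hp₀
    obtain ⟨i, hi⟩ := hne p₀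
    obtain ⟨q, -, hq⟩ := exists_of_indicatorSum_ne_zero (e := e) (c := d) (i := i)
      (h ▸ (hsc i).2 hi)
    obtain ⟨q₀, hdq, hq₀⟩ := exists_least_of_isChain hdc hq
    have hsd := indicatorSum_ne_zero_iff he hd hdq hq₀
    have hpq : p₀ = q₀ := by
      have : e p₀ = e q₀ := by
        ext j
        rw [← hsc, ← hsd, h]
      exact le_antisymm ((he _ _).2 this.ge) ((he _ _).2 this.le)
    subst hpq
    obtain ⟨i, hi, hci⟩ := exists_indicatorSum_eq he hne hcc hp₀
    obtain ⟨j, hj, hdj⟩ := exists_indicatorSum_eq he hne hdc hq₀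
    have hcd : c p₀ = d p₀ := by
      refine le_antisymm ?_ ?_
      · rw [← hdj, ← h]
        exact le_indicatorSum hc hj
      · rw [← hci, h]
        exact le_indicatorSum hd hi
    have hsupp : ∀ f : P → ℝ, Function.support (Function.update f p₀ 0) ⊆ Function.support f := by
      intro f r hr
      by_cases hr0 : r = p₀
      · subst hr0
        simp at hr
      · simpa [hr0] using hr
    have hnn : ∀ f : P → ℝ, (∀ p, 0 ≤ f p) → ∀ p, 0 ≤ Function.update f p₀ 0 p := by
      intro f hf r
      by_cases hr0 : r = p₀
      · subst hr0
        simp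
      · simpa [hr0] using hf r
    have hlt : (Function.support (Function.update c p₀ 0)).ncard < N := by
      rw [← hN]
      refine Set.ncard_lt_ncard ⟨hsupp c, fun hs => ?_⟩ (Set.toFinite _)
      simpa using hs hcp
    have := ih _ hlt (hnn c hc) (hnn d hd) (hcc.mono (hsupp c)) (hdc.mono (hsupp d))
      (funext fun i => by rw [indicatorSum_update, indicatorSum_update, h, hcd]) rfl
    funext r
    by_cases hr0 : r = p₀
    · rw [hr0, hcd]
    · simpa [hr0] using congrFun this r
  · push Not at h0
    funext p
    obtain ⟨i, hi⟩ := hne p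
    have h1 : indicatorSum e c i = 0 := by simp [indicatorSum, h0]
    have h2 := le_indicatorSum hd hi
    rw [← h, h1] at h2
    rw [h0 p]
    exact ((hd p).antisymm h2)

variable [Fintype ι] {K : Set (Finset ι)}
  (hr : ∀ F ∈ K, F.Nonempty → ∃ p, e p = F)

include he hr in
-- Layer-cake decomposition: subtracting the least positive value on the whole support gives a
-- function with strictly smaller support, to which induction applies.
theorem exists_indicatorSum_eq_of_vertexSupport_mem (hK : IsLowerSet K) {x : ι → ℝ}
    (hx : ∀ i, 0 ≤ x i) (hxK : vertexSupport x ∈ K) :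
    ∃ c : P → ℝ, (∀ p, 0 ≤ c p) ∧ IsChain (· ≤ ·) (Function.support c) ∧
      (∀ p, c p ≠ 0 → e p ⊆ vertexSupport x) ∧ indicatorSum e c = x := by
  classical
  induction hN : (vertexSupport x).card using Nat.strong_induction_on generalizing x with
  | _ N ih =>
  by_cases h0 : (vertexSupport x).Nonempty
  · obtain ⟨p₀, hp₀⟩ := hr _ hxK h0
    obtain ⟨i₀, hi₀, hmin⟩ := Finset.exists_min_image _ x h0
    have hpos : 0 < x i₀ := (hx i₀).lt_of_ne' (mem_vertexSupport.1 hi₀)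
    let y : ι → ℝ := fun i => x i - if i ∈ vertexSupport x then x i₀ else 0
    have hy : ∀ i, 0 ≤ y i := by
      intro i
      by_cases hi : i ∈ vertexSupport x
      · simpa [y, hi] using hmin i hi
      · simpa [y, hi] using hx i
    have hyx : vertexSupport y ⊂ vertexSupport x := by
      refine ⟨fun i hi => ?_, fun hs => ?_⟩
      · by_contra h
        exact mem_vertexSupport.1 hi (by simp [y, h, notMem_vertexSupport.1 h])
      · exact mem_vertexSupport.1 (hs hi₀) (by simp [y, hi₀])
    obtain ⟨c, hc, hch, hce, hcy⟩ :=
      ih _ (hN ▸ Finset.card_lt_card hyx) hy (hK hyx.1 hxK) rfl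
    have hcp : c p₀ = 0 := by
      by_contra h
      exact hyx.2 (hp₀ ▸ hce p₀ h)
    refine ⟨Function.update c p₀ (x i₀), fun p => ?_, ?_, fun p hp => ?_, ?_⟩
    · by_cases hp : p = p₀
      · subst hp
        simpa using hpos.le
      · simpa [hp] using hc p
    · have hsub : Function.support (Function.update c p₀ (x i₀)) ⊆
          insert p₀ (Function.support c) := by
        intro r hr
        by_cases hr0 : r = p₀
        · exact Or.inl hr0
        · exact Or.inr (by simpa [hr0] using hr)
      refine IsChain.mono hsub (hch.insert fun q hq _ => Or.inl ?_)
      rw [he, hp₀]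
      exact (hce q hq).trans hyx.1
    · by_cases hp0 : p = p₀
      · rw [hp0, hp₀]
      · exact (hce p (by simpa [hp0] using hp)).trans hyx.1
    · funext i
      rw [indicatorSum_update, hcp, hcy, hp₀]
      simp only [y, sub_zero]
      ring
  · rw [Finset.not_nonempty_iff_eq_empty] at h0
    have hx0 : x = 0 := funext fun i => notMem_vertexSupport.1 (by simp [h0])
    refine ⟨0, fun p => le_rfl, by simp, fun p hp => absurd rfl hp, ?_⟩
    funext i
    simp [indicatorSum, hx0]

include he hne hr in
/-- The realization of the poset of the nonempty faces of a simplicial complex is homeomorphic to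
the realization of the complex: barycentric subdivision. -/
theorem nonempty_homeomorph_complexRealization (hK : IsLowerSet K) (hmem : ∀ p, e p ∈ K) :
    Nonempty (posetRealization P ≃ₜ complexRealization K) := by
  have hcard : ∀ p, ((e p).card : ℝ) ≠ 0 := fun p =>
    Nat.cast_ne_zero.2 (Finset.card_ne_zero.2 (hne p))
  -- Division by the cardinality sends the vertex `p` to the barycentre of the face `e p`.
  let b : (P → ℝ) → ι → ℝ := fun w => indicatorSum e fun p => w p / (e p).card
  have hsupp : ∀ w : P → ℝ, (Function.support fun p => w p / ((e p).card : ℝ)) =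
      Function.support w := fun w => by
    ext p
    simp [(hne p).ne_empty]
  have hnn : ∀ w ∈ posetRealization P, ∀ p, 0 ≤ w p / ((e p).card : ℝ) := fun w hw p =>
    div_nonneg (hw.1.1 p) (Nat.cast_nonneg _)
  have hch : ∀ w ∈ posetRealization P,
      IsChain (· ≤ ·) (Function.support fun p => w p / ((e p).card : ℝ)) := fun w hw => by
    rw [hsupp]
    exact hw.2
  have hb : ∀ w ∈ posetRealization P, b w ∈ complexRealization K := by
    intro w hw
    refine ⟨⟨indicatorSum_nonneg (hnn w hw), ?_⟩, ?_⟩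
    · rw [sum_indicatorSum, ← hw.1.2]
      exact Finset.sum_congr rfl fun p _ => div_mul_cancel₀ _ (hcard p)
    · obtain ⟨p, -, hp⟩ : ∃ p ∈ Finset.univ, w p ≠ 0 := by
        refine Finset.exists_ne_zero_of_sum_ne_zero ?_
        rw [hw.1.2]
        exact one_ne_zero
      obtain ⟨p₀, h0, hp₀⟩ := exists_least_of_isChain (hch w hw) (div_ne_zero hp (hcard p))
      refine hK (fun i hi => ?_) (hmem p₀)
      exact (indicatorSum_ne_zero_iff he (hnn w hw) h0 hp₀ i).1 (mem_vertexSupport.1 hi)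
  have hbc : Continuous b := by
    refine continuous_pi fun i => continuous_finsetSum _ fun p _ => ?_
    split_ifs
    · exact (continuous_apply p).div_const _
    · exact continuous_const
  have hcompact : IsCompact (posetRealization P) := by
    have : posetRealization P = stdSimplex ℝ P ∩
        ⋂ p : P, ⋂ q : P, {w | p ≤ q ∨ q ≤ p ∨ w p = 0 ∨ w q = 0} := by
      ext w
      simp only [Set.mem_inter_iff, Set.mem_iInter, Set.mem_ofPred_eq]
      refine and_congr_right fun _ => ⟨fun h p q => ?_, fun h p hp q hq _ => ?_⟩
      · by_cases hp : w p = 0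
        · exact Or.inr (Or.inr (Or.inl hp))
        by_cases hq : w q = 0
        · exact Or.inr (Or.inr (Or.inr hq))
        rcases h.total hp hq with h | h
        · exact Or.inl h
        · exact Or.inr (Or.inl h)
      · rcases h p q with h | h | h | h
        exacts [Or.inl h, Or.inr h, absurd h hp, absurd h hq]
    rw [this]
    refine (isCompact_stdSimplex ℝ P).inter_right (isClosed_iInter fun p => isClosed_iInter fun q => ?_)
    by_cases h : p ≤ q ∨ q ≤ p
    · have huniv : {w : P → ℝ | p ≤ q ∨ q ≤ p ∨ w p = 0 ∨ w q = 0} = Set.univ :=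
        Set.eq_univ_of_forall fun w => or_assoc.1 (Or.inl h)
      rw [huniv]
      exact isClosed_univ
    · have hunion : {w : P → ℝ | p ≤ q ∨ q ≤ p ∨ w p = 0 ∨ w q = 0} =
          {w | w p = 0} ∪ {w | w q = 0} :=
        Set.ext fun w => or_assoc.symm.trans (or_iff_right h)
      rw [hunion]
      exact (isClosed_eq (continuous_apply p) continuous_const).union
        (isClosed_eq (continuous_apply q) continuous_const)
  have := isCompact_iff_compactSpace.1 hcompact
  let B : posetRealization P → complexRealization K := fun w => ⟨b w, hb w w.2⟩
  have hBc : Continuous B := (hbc.comp continuous_subtype_val).subtype_mk _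
  have hBi : Function.Injective B := by
    intro w v h
    have := indicatorSum_injective he hne (hnn w w.2) (hnn v v.2) (hch w w.2) (hch v v.2)
      (congrArg Subtype.val h)
    apply Subtype.ext
    funext p
    exact (div_left_inj' (hcard p)).1 (congrFun this p)
  have hBs : Function.Surjective B := by
    intro x
    obtain ⟨c, hc, hcc, -, hcx⟩ :=
      exists_indicatorSum_eq_of_vertexSupport_mem he hr hK x.2.1.1 x.2.2
    have hdiv : (fun p => c p * ((e p).card : ℝ) / ((e p).card : ℝ)) = c :=
      funext fun p => mul_div_cancel_right₀ _ (hcard p)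
    refine ⟨⟨fun p => c p * (e p).card, ⟨fun p => mul_nonneg (hc p) (Nat.cast_nonneg _), ?_⟩,
      ?_⟩, Subtype.ext ?_⟩
    · rw [← sum_indicatorSum, hcx]
      exact x.2.1.2
    · rw [← hsupp, hdiv]
      exact hcc
    · change indicatorSum e (fun p => c p * ((e p).card : ℝ) / ((e p).card : ℝ)) = x.1
      rw [hdiv, hcx]
  exact ⟨hBc.homeoOfEquivCompactToT2 (f := Equiv.ofBijective B ⟨hBi, hBs⟩)⟩

end Subdivision

/-! ### The complex of sets containing no complement of a line. -/

section FanoComplex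

/-- The simplicial complex of the sets which contain no member of a given family. -/
def avoiding {ι : Type*} (B : Finset (Finset ι)) : Set (Finset ι) := {F | ∀ b ∈ B, ¬ b ⊆ F}

theorem isLowerSet_avoiding {ι : Type*} (B : Finset (Finset ι)) : IsLowerSet (avoiding B) :=
  fun _ _ hGF hF b hb h => hF b hb (h.trans hGF)

theorem avoiding_insert {ι : Type*} [DecidableEq ι] (B : Finset (Finset ι)) (T : Finset ι) :
    avoiding (insert T B) = {F | F ∈ avoiding B ∧ ¬ T ⊆ F} := by
  ext F
  simp [avoiding, and_comm]

instance {ι : Type*} [DecidableEq ι] (B : Finset (Finset ι)) (F : Finset ι) :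
    Decidable (F ∈ avoiding B) :=
  inferInstanceAs (Decidable (∀ b ∈ B, ¬ b ⊆ F))

/-- The complements of the lines of the Fano plane, in a labelling of its points. -/
def fanoBlocks : Finset (Finset (Fin 7)) :=
  {{2, 3, 4, 5}, {0, 1, 4, 5}, {0, 1, 2, 3}, {1, 3, 5, 6}, {1, 2, 4, 6}, {0, 3, 4, 6}, {0, 2, 5, 6}}

/-- Eight facets of the complex of the sets which contain no complement of a line. -/
def fanoFacet (a : Fin 8) : Fin 4 ↪ Fin 7 where
  -- The lines through 6 pair off the other points as 01, 23, 45. The triangles 135, 124, 034, 025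
  -- are the blocks through 6 with 6 deleted; each is completed here by two of the three points that
  -- do not give a block.
  toFun := ![![1, 3, 5, 2], ![1, 3, 5, 4], ![1, 2, 4, 3], ![1, 2, 4, 5], ![0, 3, 4, 2],
    ![0, 3, 4, 5], ![0, 2, 5, 3], ![0, 2, 5, 4]] a
  inj' := by revert a; decide

/-- Maximality: two points always lie on a line, so any five points contain the complement of a
line. -/
theorem isFacetFamily_fanoFacet : IsFacetFamily (avoiding fanoBlocks) fanoFacet where
  mem := by decide
  maximal := by decide +kernel
  injective := by decide

/-- The supports of the eight facets. -/
def fanoFacets : Finset (Finset (Fin 7)) := Finset.univ.image fun a => Finset.univ.map (fanoFacet a)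

theorem removeFacets_fanoFacet :
    removeFacets (avoiding fanoBlocks) fanoFacet = avoiding (fanoBlocks ∪ fanoFacets) := by
  have : ∀ F, (F ∈ avoiding fanoBlocks ∧ ∀ a, F ≠ Finset.univ.map (fanoFacet a)) ↔
      F ∈ avoiding (fanoBlocks ∪ fanoFacets) := by decide +kernel
  exact Set.ext this

/-- An embedding of three elements. -/
def tripleEmbedding {α : Type*} [DecidableEq α] (x y z : α)
    (h : Function.Injective ![x, y, z]) : Fin 3 ↪ α := ⟨![x, y, z], h⟩

theorem contractibleSpace_removeFacets_fanoFacet :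
    ContractibleSpace (complexRealization (removeFacets (avoiding fanoBlocks) fanoFacet)) := by
  rw [removeFacets_fanoFacet]
  -- A fourth point added to 135 gives a block (6), a removed facet (2, 4) or the remaining face
  -- 0135, so 135 is free. The other three triangles are treated alike.
  refine contractibleSpace_complexRealization_of_collapse (isLowerSet_avoiding _)
    (tripleEmbedding 1 3 5 (by decide)) (v := 0) (by decide) (by decide +kernel)
    (by decide +kernel) ?_
  rw [← avoiding_insert]
  refine contractibleSpace_complexRealization_of_collapse (isLowerSet_avoiding _)
    (tripleEmbedding 1 2 4 (by decide)) (v := 0) (by decide) (by decide +kernel)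
    (by decide +kernel) ?_
  rw [← avoiding_insert]
  refine contractibleSpace_complexRealization_of_collapse (isLowerSet_avoiding _)
    (tripleEmbedding 0 3 4 (by decide)) (v := 1) (by decide) (by decide +kernel)
    (by decide +kernel) ?_
  rw [← avoiding_insert]
  refine contractibleSpace_complexRealization_of_collapse (isLowerSet_avoiding _)
    (tripleEmbedding 0 2 5 (by decide)) (v := 1) (by decide) (by decide +kernel)
    (by decide +kernel) ?_
  rw [← avoiding_insert]
  -- A forbidden set through 6 is a block, and deleting 6 from it leaves one of the triangles, now
  -- forbidden too. So adding 6 never creates a forbidden subset.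
  exact contractibleSpace_complexRealization_of_cone (isLowerSet_avoiding _) (v := 6)
    (by decide +kernel) ⟨∅, by decide +kernel⟩

/-- The complex of the sets which contain no complement of a line of the Fano plane is homotopy
equivalent to a wedge of eight spheres of dimension `3`. -/
theorem nonempty_homotopyEquiv_avoiding_fanoBlocks :
    Nonempty (ContinuousMap.HomotopyEquiv (complexRealization (avoiding fanoBlocks))
      (WedgeOfSpheres 8 3)) :=
  isFacetFamily_fanoFacet.nonempty_homotopyEquiv_wedgeOfSpheres (isLowerSet_avoiding _)
    (by decide) contractibleSpace_removeFacets_fanoFacet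

end FanoComplex

/-! ### Rank, real representations and determinants. -/

section MatroidRank

variable {K V : Type*} [Field K] [AddCommGroup V] [Module K V]

theorem eRank_vectorMatroid (E : Finset V) :
    (vectorMatroid K E).eRank = Module.finrank K (Submodule.span K (E : Set V)) := by
  obtain ⟨B, hB⟩ := (vectorMatroid K E).exists_isBase
  have hi := (vectorMatroid_indep_iff K E B).1 hB.indep
  have hfin : B.Finite := E.finite_toSet.subset hi.1
  have hspan : Submodule.span K B = Submodule.span K (E : Set V) := by
    refine le_antisymm (Submodule.span_mono hi.1) (Submodule.span_le.2 fun v hv => ?_)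
    by_contra hvB
    have hvB' : v ∉ B := fun h => hvB (Submodule.subset_span h)
    refine (hB.insert_dep ⟨hv, hvB'⟩).not_indep ?_
    rw [vectorMatroid_indep_iff]
    exact ⟨Set.insert_subset hv hi.1, hi.2.insert (by simpa using hvB)⟩
  have := hfin.fintype
  rw [← hB.encard_eq_eRank, ← hspan, finrank_span_set_eq_card hi.2, Set.encard_eq_coe_toFinset_card]

/-- Of total unimodularity only the existence of a real representation is kept. Extension by zero
off `E` allows arbitrary families of vectors to be tested. -/
theorem IsRegularMatroid.exists_real_vectors {E : Finset V}
    (h : IsRegularMatroid (vectorMatroid K E)) :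
    ∃ (m : ℕ) (c : V → Fin m → ℝ), ∀ (k : ℕ) (t : Fin k → V), Function.Injective t →
      (∀ i, t i ∈ E) → (LinearIndependent K t ↔ LinearIndependent ℝ (c ∘ t)) := by
  classical
  obtain ⟨m, A, -, hA⟩ := h
  refine ⟨m, fun v => if hv : v ∈ E then A.col ⟨v, hv⟩ else 0, fun k t ht htE => ?_⟩
  let s : Fin k → (vectorMatroid K E).E := fun i => ⟨t i, htE i⟩
  have hs : Function.Injective s := fun i j hij => ht (congrArg Subtype.val hij)
  have h1 := hA (Set.range s)
  rw [linearIndepOn_range_iff hs, vectorMatroid_indep_iff, ← Set.range_comp] at h1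
  have h2 : Subtype.val ∘ s = t := rfl
  have h3 : (fun v => if hv : v ∈ E then A.col ⟨v, hv⟩ else 0) ∘ t = A.col ∘ s :=
    funext fun i => dif_pos (htE i)
  rw [h2, linearIndepOn_id_range_iff ht] at h1
  rw [h3, ← h1]
  refine ⟨fun h => ⟨?_, h⟩, fun h => h.2⟩
  rintro _ ⟨i, rfl⟩
  exact htE i

/-- Three dependent vectors, any two of which are independent. -/
theorem exists_eq_smul_add_smul {x y z : V} (hxy : LinearIndependent K ![x, y])
    (hxz : LinearIndependent K ![x, z]) (hyz : LinearIndependent K ![y, z])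
    (h : ¬ LinearIndependent K ![x, y, z]) :
    ∃ α β : K, α ≠ 0 ∧ β ≠ 0 ∧ z = α • x + β • y := by
  rw [LinearIndependent.pair_iff] at hxy hxz hyz
  obtain ⟨g, hg, hne⟩ := Fintype.not_linearIndependent_iff.1 h
  have hg' : g 0 • x + g 1 • y + g 2 • z = 0 := by
    rw [← hg, Fin.sum_univ_three]
    rfl
  have h0 : g 0 ≠ 0 := fun h0 => by
    rw [h0, zero_smul, zero_add] at hg'
    obtain ⟨h1, h2⟩ := hyz _ _ hg'
    obtain ⟨i, hi⟩ := hne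
    fin_cases i
    exacts [hi h0, hi h1, hi h2]
  have h1 : g 1 ≠ 0 := fun h1 => by
    rw [h1, zero_smul, add_zero] at hg'
    exact h0 (hxz _ _ hg').1
  have h2 : g 2 ≠ 0 := fun h2 => by
    rw [h2, zero_smul, add_zero] at hg'
    exact h0 (hxy _ _ hg').1
  refine ⟨-(g 0 / g 2), -(g 1 / g 2), neg_ne_zero.2 (div_ne_zero h0 h2),
    neg_ne_zero.2 (div_ne_zero h1 h2), ?_⟩
  have hz : g 2 • z = -(g 0 • x + g 1 • y) := (neg_eq_of_add_eq_zero_right hg').symm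
  have := congrArg (fun v => (g 2)⁻¹ • v) hz
  simp only [inv_smul_smul₀ h2] at this
  rw [this]
  simp only [div_eq_inv_mul, mul_smul, neg_smul, smul_neg, smul_add, neg_add]

theorem LinearIndependent.coeff_eq {x y z : V} (h : LinearIndependent K ![x, y, z])
    {a b c a' b' c' : K} (he : a • x + b • y + c • z = a' • x + b' • y + c' • z) :
    a = a' ∧ b = b' ∧ c = c' := by
  have := Fintype.linearIndependent_iff.1 h ![a - a', b - b', c - c'] (by
    rw [Fin.sum_univ_three]
    change (a - a') • x + (b - b') • y + (c - c') • z = 0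
    rw [← sub_eq_zero] at he
    rw [← he]
    module)
  exact ⟨sub_eq_zero.1 (this 0), sub_eq_zero.1 (this 1), sub_eq_zero.1 (this 2)⟩

/-- A linearly independent subfamily of a spanning family of vectors extends to a basis. -/
theorem exists_det_ne_zero {J : Type*} {n : ℕ} {u : J → Fin n → K}
    (hu : Submodule.span K (Set.range u) = ⊤) {I : Set J} (hI : LinearIndepOn K u I) :
    ∃ t : Fin n → J, Function.Injective t ∧ I ⊆ Set.range t ∧
      (Matrix.of fun i => u (t i)).det ≠ 0 := by
  obtain ⟨b, -, hIb, hspan, hb⟩ := exists_linearIndepOn_extension hI (Set.subset_univ I)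
  rw [Set.image_univ] at hspan
  have htop : ⊤ ≤ Submodule.span K (Set.range fun j : b => u j) := by
    rw [← hu, ← Set.image_eq_range]
    exact Submodule.span_le.2 hspan
  let B := Module.Basis.mk hb htop
  have : Finite b := Module.Finite.finite_basis B
  have := Fintype.ofFinite b
  have hcard : Fintype.card b = n := by
    rw [← Module.finrank_eq_card_basis B]
    simp
  let e : Fin n ≃ b := (Fintype.equivFinOfCardEq hcard).symm
  refine ⟨fun i => e i, Subtype.val_injective.comp e.injective, fun j hj => ?_, ?_⟩
  · exact ⟨e.symm ⟨j, hIb hj⟩, by simp⟩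
  · have hli : LinearIndependent K (Matrix.of fun i => u (e i)).row :=
      LinearIndependent.comp hb e e.injective
    rw [Matrix.linearIndependent_rows_iff_isUnit, Matrix.isUnit_iff_isUnit_det] at hli
    exact hli.ne_zero

theorem linearIndepOn_of_det_ne_zero {J : Type*} {n : ℕ} {u : J → Fin n → K} {t : Fin n → J}
    (ht : Function.Injective t) {I : Set J} (hI : I ⊆ Set.range t)
    (hdet : (Matrix.of fun i => u (t i)).det ≠ 0) : LinearIndepOn K u I := by
  have hli : LinearIndependent K (Matrix.of fun i => u (t i)).row := by
    rw [Matrix.linearIndependent_rows_iff_isUnit, Matrix.isUnit_iff_isUnit_det]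
    exact hdet.isUnit
  exact ((linearIndepOn_range_iff ht u).2 hli).mono hI

theorem span_eq_top_of_det_ne_zero {J : Type*} {n : ℕ} {u : J → Fin n → K} {t : Fin n → J}
    (hdet : (Matrix.of fun i => u (t i)).det ≠ 0) : Submodule.span K (Set.range u) = ⊤ := by
  have hli : LinearIndependent K (Matrix.of fun i => u (t i)).row := by
    rw [Matrix.linearIndependent_rows_iff_isUnit, Matrix.isUnit_iff_isUnit_det]
    exact hdet.isUnit
  have h := hli.span_eq_top_of_card_eq_finrank' (by simp)
  rw [eq_top_iff, ← h]
  refine Submodule.span_mono ?_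
  rintro _ ⟨i, rfl⟩
  exact ⟨t i, rfl⟩

end MatroidRank

/-! ### Regularity and rank of sets of points of the Fano plane. -/

section FanoPlane

/-- The points of the Fano plane. -/
def fanoPoint : Fin 7 → Fin 3 → ZMod 2 :=
  ![![1, 0, 0], ![0, 1, 1], ![0, 1, 0], ![1, 0, 1], ![1, 1, 0], ![0, 0, 1], ![1, 1, 1]]

theorem fanoPoint_injective : Function.Injective fanoPoint := by decide

theorem fanoPoint_ne_zero (i : Fin 7) : fanoPoint i ≠ 0 := by revert i; decide

theorem exists_fanoPoint_eq : ∀ v : Fin 3 → ZMod 2, v ≠ 0 → ∃ i, fanoPoint i = v := by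
  decide +kernel

instance {n k : ℕ} (t : Fin k → Fin n → ZMod 2) : Decidable (LinearIndependent (ZMod 2) t) :=
  decidable_of_iff _ Fintype.linearIndependent_iff.symm

/-- The Fano matroid is not regular. -/
theorem not_isRegularMatroid_of_forall_fanoPoint_mem {E : Finset (Fin 3 → ZMod 2)}
    (hE : ∀ i, fanoPoint i ∈ E) : ¬ IsRegularMatroid (vectorMatroid (ZMod 2) E) := by
  intro h
  obtain ⟨m, c, hc⟩ := h.exists_real_vectors
  let a : Fin 7 → Fin m → ℝ := fun i => c (fanoPoint i)
  have h2 : ∀ i j, i ≠ j → LinearIndependent ℝ ![a i, a j] := by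
    intro i j hij
    have hinj : Function.Injective ![fanoPoint i, fanoPoint j] := by
      revert i j; decide +kernel
    have hli : LinearIndependent (ZMod 2) ![fanoPoint i, fanoPoint j] := by
      revert i j; decide +kernel
    have := (hc 2 _ hinj (by intro l; fin_cases l <;> exact hE _)).1 hli
    convert this using 1
    funext l
    fin_cases l <;> rfl
  have h3 : ∀ i j k, Function.Injective ![fanoPoint i, fanoPoint j, fanoPoint k] →
      (LinearIndependent (ZMod 2) ![fanoPoint i, fanoPoint j, fanoPoint k] ↔
        LinearIndependent ℝ ![a i, a j, a k]) := by
    intro i j k hinj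
    rw [hc 3 _ hinj (by intro l; fin_cases l <;> exact hE _)]
    have : c ∘ ![fanoPoint i, fanoPoint j, fanoPoint k] = ![a i, a j, a k] := by
      funext l
      fin_cases l <;> rfl
    rw [this]
  have hline : ∀ i j k, Function.Injective ![fanoPoint i, fanoPoint j, fanoPoint k] →
      ¬ LinearIndependent (ZMod 2) ![fanoPoint i, fanoPoint j, fanoPoint k] →
      ∃ α β : ℝ, α ≠ 0 ∧ β ≠ 0 ∧ a k = α • a i + β • a j := by
    intro i j k hinj hdep
    have hne : i ≠ j ∧ i ≠ k ∧ j ≠ k := by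
      refine ⟨?_, ?_, ?_⟩
      · rintro rfl
        exact absurd (@hinj 0 1 rfl) (by decide)
      · rintro rfl
        exact absurd (@hinj 0 2 rfl) (by decide)
      · rintro rfl
        exact absurd (@hinj 1 2 rfl) (by decide)
    exact exists_eq_smul_add_smul (h2 i j hne.1) (h2 i k hne.2.1) (h2 j k hne.2.2)
      ((h3 i j k hinj).not.1 hdep)
  -- Points 4, 3, 1 lie on the sides of the triangle 0, 2, 5. Point 6 is expressed through three
  -- lines; the seventh line, 4, 3, 1, gives the contradiction.
  have hbasis := (h3 0 2 5 (by decide) ).1 (by decide +kernel)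
  obtain ⟨α, β, hα, hβ, e4⟩ := hline 0 2 4 (by decide) (by decide +kernel)
  obtain ⟨γ, δ, hγ, hδ, e3⟩ := hline 0 5 3 (by decide) (by decide +kernel)
  obtain ⟨ε, ζ, hε, hζ, e1⟩ := hline 2 5 1 (by decide) (by decide +kernel)
  obtain ⟨lam, κ, -, -, e6⟩ := hline 5 4 6 (by decide) (by decide +kernel)
  obtain ⟨μ, ν, -, hν, e6'⟩ := hline 2 3 6 (by decide) (by decide +kernel)
  obtain ⟨ρ, τ, -, hτ, e6''⟩ := hline 0 1 6 (by decide) (by decide +kernel)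
  obtain ⟨ξ, η, hξ, -, e1'⟩ := hline 4 3 1 (by decide) (by decide +kernel)
  have r1 : (κ * α) • a 0 + (κ * β) • a 2 + lam • a 5 =
      (ν * γ) • a 0 + μ • a 2 + (ν * δ) • a 5 := by
    have : a 6 = a 6 := rfl
    nth_rewrite 1 [e6] at this
    rw [e6', e4, e3] at this
    linear_combination (norm := module) this
  have r2 : (κ * α) • a 0 + (κ * β) • a 2 + lam • a 5 =
      ρ • a 0 + (τ * ε) • a 2 + (τ * ζ) • a 5 := by
    have : a 6 = a 6 := rfl
    nth_rewrite 1 [e6] at this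
    rw [e6'', e4, e1] at this
    linear_combination (norm := module) this
  have r3 : (0 : ℝ) • a 0 + ε • a 2 + ζ • a 5 =
      (ξ * α + η * γ) • a 0 + (ξ * β) • a 2 + (η * δ) • a 5 := by
    have := e1
    rw [e1', e4, e3] at this
    linear_combination (norm := module) -this
  obtain ⟨c1, -, c3⟩ := hbasis.coeff_eq r1
  obtain ⟨-, d2, d3⟩ := hbasis.coeff_eq r2
  obtain ⟨f1, f2, f3⟩ := hbasis.coeff_eq r3
  have hκ : κ = τ * ξ := mul_right_cancel₀ hβ (by rw [d2, f2]; ring)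
  have hν' : ν = τ * η := mul_right_cancel₀ hδ (by rw [← c3, d3, f3]; ring)
  -- The first coordinates give τξα = τηγ and ξα + ηγ = 0, hence 2τξα = 0. This is where
  -- characteristic different from 2 enters.
  have : τ * (ξ * α) = 0 := by
    rw [hκ, hν'] at c1
    linear_combination (1 / 2 : ℝ) * c1 - (τ / 2) * f1
  exact mul_ne_zero hτ (mul_ne_zero hξ hα) this

theorem span_ne_top_iff_exists_dotProduct {S : Set (Fin 3 → ZMod 2)} :
    Submodule.span (ZMod 2) S ≠ ⊤ ↔ ∃ φ : Fin 3 → ZMod 2, φ ≠ 0 ∧ ∀ v ∈ S, φ ⬝ᵥ v = 0 := by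
  constructor
  · intro h
    obtain ⟨f, hf, hle⟩ := Submodule.exists_le_ker_of_lt_top _ (lt_top_iff_ne_top.2 h)
    have hfd : ∀ v, f v = (fun i => f (Pi.single i 1)) ⬝ᵥ v := by
      intro v
      rw [LinearMap.pi_apply_eq_sum_univ f v]
      simp only [dotProduct, smul_eq_mul]
      refine Finset.sum_congr rfl fun i _ => ?_
      rw [mul_comm]
      congr 2
      funext j
      simp [Pi.single_apply, eq_comm]
    refine ⟨fun i => f (Pi.single i 1), fun h0 => hf ?_, fun v hv => ?_⟩
    · exact LinearMap.ext fun v => by rw [hfd, h0, zero_dotProduct]; rfl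
    · rw [← hfd]
      exact hle (Submodule.subset_span hv)
  · rintro ⟨φ, hφ, h⟩ htop
    let f : (Fin 3 → ZMod 2) →ₗ[ZMod 2] ZMod 2 := dotProductBilin (ZMod 2) (ZMod 2) φ
    have hker : Submodule.span (ZMod 2) S ≤ f.ker := Submodule.span_le.2 fun v hv => h v hv
    rw [htop] at hker
    refine hφ (funext fun i => ?_)
    have : f (Pi.single i 1) = 0 := hker trivial
    simpa [f, dotProductBilin] using this

theorem eRank_vectorMatroid_eq_three_iff {E : Finset (Fin 3 → ZMod 2)} :
    (vectorMatroid (ZMod 2) E).eRank = 3 ↔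
      Submodule.span (ZMod 2) (E : Set (Fin 3 → ZMod 2)) = ⊤ := by
  rw [eRank_vectorMatroid]
  constructor
  · intro h
    refine Submodule.eq_top_of_finrank_eq ?_
    rw [Module.finrank_fin_fun]
    exact_mod_cast h
  · intro h
    rw [h, finrank_top, Module.finrank_fin_fun]
    rfl

/-- The set of the labels of the points missing from a set of vectors. -/
def missingPoints (E : Finset (Fin 3 → ZMod 2)) : Finset (Fin 7) :=
  Finset.univ.filter fun i => fanoPoint i ∉ E

theorem mem_missingPoints {E : Finset (Fin 3 → ZMod 2)} {i : Fin 7} :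
    i ∈ missingPoints E ↔ fanoPoint i ∉ E := by
  simp [missingPoints]

/-- A set fails to span when a nonzero functional kills it, that is, when it lies on a line and its
missing points include that line's complement. -/
theorem mem_avoiding_fanoBlocks_iff {E : Finset (Fin 3 → ZMod 2)} (h0 : 0 ∉ E) :
    missingPoints E ∈ avoiding fanoBlocks ↔
      (vectorMatroid (ZMod 2) E).eRank = 3 := by
  have k1 : ∀ b ∈ fanoBlocks, ∃ φ : Fin 3 → ZMod 2, φ ≠ 0 ∧ ∀ i, i ∉ b → φ ⬝ᵥ fanoPoint i = 0 := by
    decide +kernel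
  have k2 : ∀ φ : Fin 3 → ZMod 2, φ ≠ 0 → ∃ b ∈ fanoBlocks, ∀ i ∈ b, φ ⬝ᵥ fanoPoint i ≠ 0 := by
    decide +kernel
  rw [eRank_vectorMatroid_eq_three_iff, ← not_iff_not, ← Ne, span_ne_top_iff_exists_dotProduct]
  constructor
  · intro h
    simp only [avoiding, Set.mem_ofPred_eq, not_forall, not_not] at h
    obtain ⟨b, hb, hbE⟩ := h
    obtain ⟨φ, hφ, hφb⟩ := k1 b hb
    refine ⟨φ, hφ, fun v hv => ?_⟩
    obtain ⟨i, rfl⟩ := exists_fanoPoint_eq v fun hv0 => h0 (hv0 ▸ hv)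
    exact hφb i fun hi => mem_missingPoints.1 (hbE hi) hv
  · rintro ⟨φ, hφ, h⟩ hav
    obtain ⟨b, hb, hbφ⟩ := k2 φ hφ
    refine hav b hb fun i hi => mem_missingPoints.2 fun hiE => hbφ i hi ?_
    exact h _ hiE

/-- Integral lifts of the vectors over `F₂` with three coordinates, forming a totally unimodular
matrix away from the vector `(1, 1, 1)`. -/
def signedLift (x : Fin 3 → ZMod 2) : Fin 3 → ℤ :=
  -- With these signs every vector other than (1, 1, 1) has at most one entry 1 and at most one
  -- entry -1. Apart from the zero column this is the incidence matrix of an oriented K₄ with one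
  -- row deleted.
  ![(x 0).val, if x 0 = 0 then (x 1).val else -(x 1).val, -(x 2).val]

theorem cast_signedLift : ∀ (x : Fin 3 → ZMod 2) (i : Fin 3), (signedLift x i : ZMod 2) = x i := by
  decide +kernel

theorem natAbs_signedLift_le : ∀ (x : Fin 3 → ZMod 2) (i : Fin 3),
    (signedLift x i).natAbs ≤ 1 := by
  decide +kernel

theorem natAbs_det_two_signedLift_le : ∀ x y : Fin 3 → ZMod 2, x ≠ 1 → y ≠ 1 → ∀ i j : Fin 3,
    (signedLift x i * signedLift y j - signedLift y i * signedLift x j).natAbs ≤ 1 := by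
  decide +kernel

theorem natAbs_det_three_signedLift_le : ∀ x y z : Fin 3 → ZMod 2, x ≠ 1 → y ≠ 1 → z ≠ 1 →
    ∀ i j k : Fin 3, (signedLift x i * signedLift y j * signedLift z k -
      signedLift x i * signedLift z j * signedLift y k -
      signedLift y i * signedLift x j * signedLift z k +
      signedLift y i * signedLift z j * signedLift x k +
      signedLift z i * signedLift x j * signedLift y k -
      signedLift z i * signedLift y j * signedLift x k).natAbs ≤ 1 := by
  decide +kernel

/-- The matrix whose columns are the signed lifts of the vectors other than `(1, 1, 1)`. -/
def signedLiftMatrix : Matrix (Fin 3) {x : Fin 3 → ZMod 2 // x ≠ 1} ℤ :=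
  Matrix.of fun i x => signedLift x.1 i

theorem natAbs_det_submatrix_signedLiftMatrix_le {k : ℕ} {f : Fin k → Fin 3}
    (hf : Function.Injective f) (g : Fin k → {x : Fin 3 → ZMod 2 // x ≠ 1}) :
    (signedLiftMatrix.submatrix f g).det.natAbs ≤ 1 := by
  have hk : k ≤ 3 := by simpa using Fintype.card_le_of_injective f hf
  interval_cases k
  · simp
  · rw [Matrix.det_fin_one]
    exact natAbs_signedLift_le _ _
  · rw [Matrix.det_fin_two]
    exact natAbs_det_two_signedLift_le _ _ (g 0).2 (g 1).2 _ _
  · rw [Matrix.det_fin_three]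
    exact natAbs_det_three_signedLift_le _ _ _ (g 0).2 (g 1).2 (g 2).2 _ _ _

theorem signType_cast_of_natAbs_le_one {R : Type*} [CommRing R] {d : ℤ} (hd : d.natAbs ≤ 1) :
    (d : R) ∈ Set.range (SignType.cast : SignType → R) := by
  have : d = 0 ∨ d = 1 ∨ d = -1 := by omega
  rcases this with rfl | rfl | rfl
  exacts [⟨0, by simp⟩, ⟨1, by simp⟩, ⟨-1, by simp⟩]

/-- A linear automorphism of `F₂³` which maps a given nonzero vector to `(1, 1, 1)`. -/
theorem exists_linearEquiv_eq_one {v : Fin 3 → ZMod 2} (hv : v ≠ 0) :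
    ∃ g : (Fin 3 → ZMod 2) ≃ₗ[ZMod 2] (Fin 3 → ZMod 2), g v = 1 := by
  obtain ⟨i, hi⟩ := Function.ne_iff.1 hv
  have hi1 : v i = 1 := by
    have : ∀ a : ZMod 2, a ≠ 0 → a = 1 := by decide
    exact this _ hi
  -- Coordinate `i` of 1 - v vanishes, so this map preserves the coordinate `i` and is an involution
  -- in characteristic 2.
  let f : (Fin 3 → ZMod 2) →ₗ[ZMod 2] (Fin 3 → ZMod 2) :=
    LinearMap.id + (LinearMap.proj i).smulRight (1 - v)
  have hf : ∀ x, f x = x + x i • (1 - v) := fun x => rfl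
  have hinv : Function.Involutive f := by
    intro x
    have h1 : f x i = x i := by simp [hf, hi1]
    rw [hf, h1, hf, add_assoc, ← add_smul, CharTwo.add_self_eq_zero, zero_smul, add_zero]
  refine ⟨LinearEquiv.ofInvolutive f hinv, ?_⟩
  change f v = 1
  rw [hf, hi1]
  simp

/-- The matroid of a spanning set of nonzero vectors in `F₂³` is regular if it misses a nonzero
vector. -/
theorem isRegularMatroid_of_notMem {E : Finset (Fin 3 → ZMod 2)} {v : Fin 3 → ZMod 2}
    (hv : v ≠ 0) (hvE : v ∉ E)
    (hE : Submodule.span (ZMod 2) (E : Set (Fin 3 → ZMod 2)) = ⊤) :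
    IsRegularMatroid (vectorMatroid (ZMod 2) E) := by
  obtain ⟨g, hg⟩ := exists_linearEquiv_eq_one hv
  let M := vectorMatroid (ZMod 2) E
  let s : M.E → {x : Fin 3 → ZMod 2 // x ≠ 1} := fun x => ⟨g x.1, fun h => by
    rw [← hg] at h
    exact hvE (g.injective h ▸ x.2)⟩
  let A : Matrix (Fin 3) M.E ℝ := (signedLiftMatrix.submatrix id s).map (Int.cast : ℤ → ℝ)
  refine ⟨3, A, fun k f t hf ht => ?_, fun I => ?_⟩
  · have : (A.submatrix f t).det = ((signedLiftMatrix.submatrix f (s ∘ t)).det : ℝ) := by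
      rw [Int.cast_det]
      rfl
    rw [this]
    exact signType_cast_of_natAbs_le_one (natAbs_det_submatrix_signedLiftMatrix_le hf _)
  let u : M.E → Fin 3 → ZMod 2 := fun x => g x.1
  have hu : Submodule.span (ZMod 2) (Set.range u) = ⊤ := by
    have : Set.range u = g '' (E : Set (Fin 3 → ZMod 2)) := by
      rw [Set.image_eq_range]
      rfl
    rw [this]
    have := Submodule.map_span g.toLinearMap (E : Set (Fin 3 → ZMod 2))
    rw [hE, Submodule.map_top, LinearEquiv.range] at this
    exact this.symm
  let d : (Fin 3 → M.E) → ℤ := fun t => (signedLiftMatrix.submatrix id (s ∘ t)).det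
  have hd : ∀ t, (d t).natAbs ≤ 1 := fun t =>
    natAbs_det_submatrix_signedLiftMatrix_le Function.injective_id _
  have hdu : ∀ t, (Matrix.of fun i => u (t i)).det = (d t : ZMod 2) := by
    intro t
    rw [Int.cast_det, ← Matrix.det_transpose]
    congr 1
    ext i j
    exact (cast_signedLift (g (t j).1) i).symm
  have hdA : ∀ t, (Matrix.of fun i => A.col (t i)).det = (d t : ℝ) := by
    intro t
    rw [Int.cast_det, ← Matrix.det_transpose]
    rfl
  -- An integer among 0, 1, -1 vanishes modulo 2 exactly when it vanishes in ℝ. So the same triples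
  -- are bases over both fields, and independent sets are the subsets of bases.
  have hdet : ∀ t : Fin 3 → M.E, (Matrix.of fun i => u (t i)).det ≠ 0 ↔
      (Matrix.of fun i => A.col (t i)).det ≠ 0 := by
    intro t
    rw [hdu, hdA]
    have := hd t
    have : d t = 0 ∨ d t = 1 ∨ d t = -1 := by omega
    rcases this with h | h | h <;> simp [h]
  have hA : Submodule.span ℝ (Set.range A.col) = ⊤ := by
    obtain ⟨t, -, -, ht⟩ := exists_det_ne_zero hu (linearIndepOn_empty (ZMod 2) u)
    exact span_eq_top_of_det_ne_zero ((hdet t).1 ht)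
  have hI : M.Indep (Subtype.val '' I) ↔ LinearIndepOn (ZMod 2) u I := by
    rw [vectorMatroid_indep_iff, and_iff_right, ← linearIndepOn_iff_image
      Subtype.val_injective.injOn]
    · exact (LinearMap.linearIndepOn_iff_of_injOn g.toLinearMap g.injective.injOn).symm
    · rintro _ ⟨x, -, rfl⟩
      exact x.2
  rw [hI]
  constructor
  · intro h
    obtain ⟨t, ht, hIt, hdt⟩ := exists_det_ne_zero hu h
    exact linearIndepOn_of_det_ne_zero ht hIt ((hdet t).1 hdt)
  · intro h
    obtain ⟨t, ht, hIt, hdt⟩ := exists_det_ne_zero hA h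
    exact linearIndepOn_of_det_ne_zero ht hIt ((hdet t).2 hdt)

end FanoPlane

/-! ### The poset as the reversed face poset of the complex. -/

section Main

theorem subset_iff_missingPoints_subset {E F : Finset (Fin 3 → ZMod 2)}
    (hE : (0 : Fin 3 → ZMod 2) ∉ E) : E ⊆ F ↔ missingPoints F ⊆ missingPoints E := by
  constructor
  · intro h i hi
    rw [mem_missingPoints] at hi ⊢
    exact fun hiE => hi (h hiE)
  · intro h v hv
    obtain ⟨i, rfl⟩ := exists_fanoPoint_eq v fun hv0 => hE (hv0 ▸ hv)
    by_contra hiF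
    exact mem_missingPoints.1 (h (mem_missingPoints.2 hiF)) hv

theorem nonempty_homeomorph_avoiding_fanoBlocks :
    Nonempty (posetRealization (IR 3) ≃ₜ complexRealization (avoiding fanoBlocks)) := by
  refine nonempty_homeomorph_complexRealization (e := fun E : IR 3 => missingPoints E.1)
    (fun E F => subset_iff_missingPoints_subset E.2.1) (fun E => ?_) (fun F hF hne => ?_)
    (isLowerSet_avoiding _) (fun E => (mem_avoiding_fanoBlocks_iff E.2.1).2 E.2.2.2)
  -- A regular set is not the whole Fano plane, so its set of missing points is a nonempty face.
  · by_contra h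
    refine not_isRegularMatroid_of_forall_fanoPoint_mem (fun i => ?_) E.2.2.1
    by_contra hi
    exact h ⟨i, mem_missingPoints.2 hi⟩
  -- Conversely, the complement of a nonempty face spans and misses a point, hence is regular.
  · let E : Finset (Fin 3 → ZMod 2) := Fᶜ.image fanoPoint
    have h0 : (0 : Fin 3 → ZMod 2) ∉ E := by
      intro h
      obtain ⟨i, -, hi⟩ := Finset.mem_image.1 h
      exact fanoPoint_ne_zero i hi
    have hmiss : missingPoints E = F := by
      ext i
      rw [mem_missingPoints, fanoPoint_injective.mem_finset_image, Finset.mem_compl, not_not]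
    have hrank : (vectorMatroid (ZMod 2) E).eRank = 3 :=
      (mem_avoiding_fanoBlocks_iff h0).1 (hmiss.symm ▸ hF)
    obtain ⟨i, hi⟩ := hne
    refine ⟨⟨E, h0, isRegularMatroid_of_notMem (fanoPoint_ne_zero i) ?_
      (eRank_vectorMatroid_eq_three_iff.1 hrank), hrank⟩, hmiss⟩
    rw [← hmiss] at hi
    exact mem_missingPoints.1 hi

end Main

theorem mainTheorem2 :
    Nonempty (ContinuousMap.HomotopyEquiv (posetRealization (IR 3)) (WedgeOfSpheres 8 3)) := by
  obtain ⟨h⟩ := nonempty_homeomorph_avoiding_fanoBlocks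
  obtain ⟨h'⟩ := nonempty_homotopyEquiv_avoiding_fanoBlocks
  exact ⟨h.toHomotopyEquiv.trans h'⟩
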